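/- **Setting.** Let $k$ be a field and $K$ an algebraically closed extension field of $k$ (for instance $K=k$ if $k$ is algebraically closed). Let $S=k[x_{00},x_{01},x_{02},x_{11},x_{12},x_{22}]$ with its standard grading; for $a\in\mathbb Z$ let $S(a)$ be the graded $S$-module with $S(a)_n=S_{a+n}$. Let $\sigma:\mathbb P^2\to\mathbb P^5$, $(a_0:a_1:a_2)\mapsto(a_0^2:a_0a_1:a_0a_2:a_1^2:a_1a_2:a_2^2)$ be the Veronese embedding, $\theta:S\to k[x_0,x_1,x_2]$ the $k$-algebra map $x_{ij}\mapsto x_ix_j$, and $$\Delta_{00}=x_{11}x_{22}-x_{12}^2,\quad \Delta_{01}=x_{01}x_{22}-x_{12}x_{02},\quad \Delta_{02}=x_{01}x_{12}-x_{02}x_{11},$$ $$\Delta_{11}=x_{00}x_{22}-x_{02}^2,\quad \Delta_{12}=x_{00}x_{12}-x_{02}x_{01},\quad \Delta_{22}=x_{00}x_{11}-x_{01}^2 .$$ A monomial $x_0^ix_1^jx_2^l$ of even degree is lifted to $S$ as $x_{00}^{\lfloor i/2\rfloor}x_{11}^{\lfloor j/2\rfloor}x_{22}^{\lfloor l/2\rfloor}\cdot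 u$, where $u=1$ if $i,j,l$ are all even, and $u=x_{12}$, $x_{02}$, $x_{01}$ if exactly $i$, exactly $j$, exactly $l$, respectively, is even; forms of even degree are lifted term by term. For $f=\sum a_{ijl}x_0^ix_1^jx_2^l$ of odd degree put $$h_\bullet=\sum a_{ijl}\,x_{00}^{\lfloor i/2\rfloor}x_{11}^{\lfloor j/2\rfloor}x_{22}^{\lfloor l/2\rfloor},$$ the sum running over the $(i,j,l)$ with all of $i,j,l$ odd for $h_I$, only $i$ odd for $h_{II}$, only $j$ odd for $h_{III}$, only $l$ odd for $h_{IV}$. **Theorem 7.** Let $m\ge2$, let $f\in k[x_0,x_1,x_2]$ be an irreducible form of degree $2m-1$, let $C=\{f=0\}\subset\mathbb P^2(K)$, and let $I_C\subset S$ be the homogeneous ideal of $\sigma(C)\subset\mathbb P^5(K)$, that is, the ideal generated by the homogeneous polynomials of $S$ vanishing on $\sigma(C)$. Let $F_0,F_1,F_2$ be the lifts of $x_0f,x_1f,x_2f$. Then $\theta(F_n)=x_nf$ for $n=0,1,2$, the ideal $I_C$ is generated by the six $\Delta_{ij}$ and $F_0,F_1,F_2$, and $S/I_C$ has the minimal graded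 free resolution $$0\to S(-m-4)\xrightarrow{\beta_4}S(-4)^3\oplus S(-m-2)^6\xrightarrow{\beta_3}S(-3)^8\oplus S(-m-1)^8\xrightarrow{\beta_2}S(-2)^6\oplus S(-m)^3\xrightarrow{\beta_1}S\to S/I_C\to0$$ (an exact sequence of graded $S$-modules with degree-$0$ maps, such that all entries of the matrices $\beta_i$ lie in the ideal generated by the variables), where $$\beta_1=[\Delta_{00},\Delta_{01},\Delta_{02},\Delta_{11},\Delta_{12},\Delta_{22},F_0,F_1,F_2],\quad \beta_2=\begin{bmatrix}M_2&V\\0&Y\end{bmatrix},\quad \beta_3=\begin{bmatrix}M_3&K'\\0&L\end{bmatrix},\quad \beta_4=J,$$ $$M_2=\begin{bmatrix} x_{02}&0&x_{01}&0&0&x_{00}&0&0\\ -x_{12}&x_{02}&-x_{11}&x_{01}&0&0&x_{00}&0\\ x_{22}&0&x_{12}&x_{02}&x_{01}&x_{02}&0&x_{00}\\ 0&-x_{12}&0&-x_{11}&0&-x_{11}&-x_{01}&0\\ 0&x_{22}&0&0&-x_{11}&x_{12}&x_{02}&-x_{01}\\ 0&0&0&x_{22}&x_{12}&0&0&x_{02}\end{bmatrix},\qquad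 M_3=\begin{bmatrix}x_{01}&x_{00}&0\\-x_{11}&-x_{01}&0\\-x_{02}&0&x_{00}\\x_{12}&x_{02}&0\\-x_{22}&0&x_{02}\\0&-x_{02}&-x_{01}\\0&x_{12}&x_{11}\\0&-x_{22}&-x_{12}\end{bmatrix}.$$ The columns $V_1,\dots,V_8$ of $\begin{bmatrix}V\\Y\end{bmatrix}$ are the transposes of $$\begin{aligned} V_1&:(0,0,-x_{00}h_I,0,h_{IV},h_{III}\mid x_{01},-x_{00},0)\\ V_2&:(0,0,h_{IV},0,-x_{11}h_I,-h_{II}\mid x_{11},-x_{01},0)\\ V_3&:(0,x_{00}h_I,0,h_{IV},h_{III},0\mid x_{02},0,-x_{00})\\ V_4&:(x_{00}h_I,h_{IV},0,0,-h_{II},-x_{22}h_I\mid x_{12},0,-x_{01})\\ V_5&:(0,-h_{III},0,-h_{II},-x_{22}h_I,0\mid x_{22},0,-x_{02})\\ V_6&:(0,h_{IV},h_{III},x_{11}h_I,0,-x_{22}h_I\mid 0,x_{02},-x_{01})\\ V_7&:(h_{IV},x_{11}h_I,-h_{II},0,0,0\mid 0,x_{12},-x_{11})\\ V_8&:(-h_{III},-h_{II},x_{22}h_I,0,0,0\mid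 0,x_{22},-x_{12}), \end{aligned}$$ the columns $K_1,\dots,K_6$ of $\begin{bmatrix}K'\\L\end{bmatrix}$ are the transposes of $$\begin{aligned} K_1&:(0,0,0,x_{00}h_I,0,0,-h_{IV},-h_{III}\mid x_{02},0,-x_{01},0,0,x_{00},0,0)\\ K_2&:(0,0,x_{00}h_I,0,-h_{III},-h_{IV},x_{11}h_I,h_{II}\mid x_{12},x_{02},-x_{11},-x_{01},0,x_{01},x_{00},0)\\ K_3&:(-x_{00}h_I,-h_{IV},0,-h_{III},0,h_{III},h_{II},x_{22}h_I\mid x_{22},0,-x_{12},x_{02},-x_{01},0,0,x_{00})\\ K_4&:(0,0,-h_{IV},-x_{11}h_I,h_{II},x_{11}h_I,0,0\mid 0,x_{12},0,-x_{11},0,0,x_{01},0)\\ K_5&:(-h_{IV},-x_{11}h_I,h_{III},h_{II},-x_{22}h_I,0,0,0\mid 0,x_{22},0,0,-x_{11},-x_{12},x_{02},x_{01})\\ K_6&:(h_{III},h_{II},0,0,0,-x_{22}h_I,0,0\mid 0,0,0,x_{22},-x_{12},-x_{22},0,x_{02}), \end{aligned}$$ and $J$ is the column with the nine entries $$\begin{aligned}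 &-x_{00}x_{12}h_I-x_{00}h_{II}-x_{01}h_{III}-x_{02}h_{IV},\\ &x_{11}x_{02}h_I+x_{01}h_{II}+x_{11}h_{III}+x_{12}h_{IV},\\ &-x_{01}x_{22}h_I-x_{02}h_{II}-x_{12}h_{III}-x_{22}h_{IV},\\ &x_{12}^2-x_{11}x_{22},\quad -x_{02}x_{12}+x_{01}x_{22},\quad x_{11}x_{02}-x_{01}x_{12},\\ &x_{02}^2-x_{00}x_{22},\quad -x_{01}x_{02}+x_{00}x_{12},\quad x_{01}^2-x_{00}x_{11}. \end{aligned}$$ -/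

import Mathlib

namespace VeroneseCurve

noncomputable section

open MvPolynomial
open scoped LinearAlgebra.Projectivization

/-! ### Projective varieties and their homogeneous ideals

Polynomials have coefficients in a field `k`, points have coordinates in an extension `K` of `k`. -/

/-- The polynomial `G` vanishes at the point `p` of projective space (at every choice of
homogeneous coordinates of `p`). -/
def VanishesAt {k K : Type*} [Field k] [Field K] [Algebra k K] {N : ℕ}
    (G : MvPolynomial (Fin N) k) (p : ℙ K (Fin N → K)) : Prop :=
  ∀ (v : Fin N → K) (hv : v ≠ 0), Projectivization.mk K v hv = p → aeval v G = 0

/-- The projective hypersurface `Z(f)`. -/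
def zeros {k : Type*} (K : Type*) [Field k] [Field K] [Algebra k K] {N : ℕ}
    (f : MvPolynomial (Fin N) k) : Set (ℙ K (Fin N → K)) :=
  {p | VanishesAt f p}

/-- The homogeneous ideal of a set `Z` of points of projective space: the ideal generated by the
homogeneous polynomials which vanish at all points of `Z`. -/
def homogeneousIdeal (k : Type*) {K : Type*} [Field k] [Field K] [Algebra k K] {N : ℕ}
    (Z : Set (ℙ K (Fin N → K))) : Ideal (MvPolynomial (Fin N) k) :=
  Ideal.span {G | (∃ n, G.IsHomogeneous n) ∧ ∀ p ∈ Z, VanishesAt G p}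

/-! ### The Veronese embedding -/

/-- The Veronese map on homogeneous coordinates. -/
def veroneseVec {K : Type*} [Field K] (a : Fin 3 → K) : Fin 6 → K :=
  ![a 0 ^ 2, a 0 * a 1, a 0 * a 2, a 1 ^ 2, a 1 * a 2, a 2 ^ 2]

theorem veroneseVec_ne_zero {K : Type*} [Field K] {a : Fin 3 → K} (ha : a ≠ 0) :
    veroneseVec a ≠ 0 := by
  intro h
  apply ha
  have h0 : a 0 ^ 2 = 0 := congrFun h 0
  have h1 : a 1 ^ 2 = 0 := congrFun h 3
  have h2 : a 2 ^ 2 = 0 := congrFun h 5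
  funext i
  fin_cases i
  · exact pow_eq_zero_iff (two_ne_zero) |>.1 h0
  · exact pow_eq_zero_iff (two_ne_zero) |>.1 h1
  · exact pow_eq_zero_iff (two_ne_zero) |>.1 h2

theorem veroneseVec_smul {K : Type*} [Field K] (t : K) (a : Fin 3 → K) :
    veroneseVec (t • a) = t ^ 2 • veroneseVec a := by
  funext i
  fin_cases i <;> simp [veroneseVec] <;> ring

/-- The Veronese embedding `σ : ℙ² → ℙ⁵`. -/
def veronese {K : Type*} [Field K] : ℙ K (Fin 3 → K) → ℙ K (Fin 6 → K) :=
  Projectivization.lift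
    (fun a => Projectivization.mk K (veroneseVec (a : Fin 3 → K)) (veroneseVec_ne_zero a.2))
    (by
      intro a b t h
      refine (Projectivization.mk_eq_mk_iff' K _ _ _ _).2 ⟨t ^ 2, ?_⟩
      rw [h, veroneseVec_smul])

/-- The coordinate ring `S = k[x₀₀, x₀₁, x₀₂, x₁₁, x₁₂, x₂₂]` of `ℙ⁵`. -/
abbrev S (k : Type*) [Field k] : Type _ := MvPolynomial (Fin 6) k

/-- The coordinate ring `k[x₀, x₁, x₂]` of `ℙ²`. -/
abbrev R (k : Type*) [Field k] : Type _ := MvPolynomial (Fin 3) k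

abbrev x₀₀ {k : Type*} [Field k] : S k := X 0
abbrev x₀₁ {k : Type*} [Field k] : S k := X 1
abbrev x₀₂ {k : Type*} [Field k] : S k := X 2
abbrev x₁₁ {k : Type*} [Field k] : S k := X 3
abbrev x₁₂ {k : Type*} [Field k] : S k := X 4
abbrev x₂₂ {k : Type*} [Field k] : S k := X 5

/-- The homomorphism `θ : S → k[x₀, x₁, x₂]`, `x_ij ↦ x_i x_j`. -/
def theta (k : Type*) [Field k] : S k →ₐ[k] R k :=
  aeval ![X 0 * X 0, X 0 * X 1, X 0 * X 2, X 1 * X 1, X 1 * X 2, X 2 * X 2]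

/-- The six minors `Δ₀₀, Δ₀₁, Δ₀₂, Δ₁₁, Δ₁₂, Δ₂₂`. -/
def delta (k : Type*) [Field k] : Fin 6 → S k :=
  ![x₁₁ * x₂₂ - x₁₂ ^ 2,
    x₀₁ * x₂₂ - x₁₂ * x₀₂,
    x₀₁ * x₁₂ - x₀₂ * x₁₁,
    x₀₀ * x₂₂ - x₀₂ ^ 2,
    x₀₀ * x₁₂ - x₀₂ * x₀₁,
    x₀₀ * x₁₁ - x₀₁ ^ 2]

/-! ### Lifting polynomials along `θ` -/

/-- The lift to `S` of a monomial `x₀ ^ i * x₁ ^ j * x₂ ^ l` of even degree, by the parities of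
the exponents. -/
def monomialLift (k : Type*) [Field k] (e : Fin 3 →₀ ℕ) : S k :=
  x₀₀ ^ (e 0 / 2) * x₁₁ ^ (e 1 / 2) * x₂₂ ^ (e 2 / 2) *
    (if Even (e 0) ∧ Odd (e 1) ∧ Odd (e 2) then x₁₂
     else if Odd (e 0) ∧ Even (e 1) ∧ Odd (e 2) then x₀₂
     else if Odd (e 0) ∧ Odd (e 1) ∧ Even (e 2) then x₀₁
     else 1)

/-- The lift to `S` of a form of even degree, monomial by monomial. -/
def evenLift {k : Type*} [Field k] (g : R k) : S k :=
  ∑ e ∈ g.support, C (g.coeff e) * monomialLift k e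

/-- `F₀, F₁, F₂`: the lifts of `x₀ f, x₁ f, x₂ f`. -/
def F {k : Type*} [Field k] (f : R k) (n : Fin 3) : S k := evenLift (X n * f)

/-- For a parity vector `ε`, the sum of `a_e x₀₀ ^ ⌊e₀/2⌋ x₁₁ ^ ⌊e₁/2⌋ x₂₂ ^ ⌊e₂/2⌋` over the terms
`a_e x ^ e` of `f` with `e ≡ ε` modulo `2`. -/
def parityPart {k : Type*} [Field k] (ε : Fin 3 → ℕ) (f : R k) : S k :=
  ∑ e ∈ f.support with (∀ i, e i % 2 = ε i),
    C (f.coeff e) * (x₀₀ ^ (e 0 / 2) * x₁₁ ^ (e 1 / 2) * x₂₂ ^ (e 2 / 2))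

/-- `h_I`: all three exponents odd. -/
def hI {k : Type*} [Field k] (f : R k) : S k := parityPart ![1, 1, 1] f

/-- `h_II`: the exponent of `x₀` odd, the others even. -/
def hII {k : Type*} [Field k] (f : R k) : S k := parityPart ![1, 0, 0] f

/-- `h_III`: the exponent of `x₁` odd, the others even. -/
def hIII {k : Type*} [Field k] (f : R k) : S k := parityPart ![0, 1, 0] f

/-- `h_IV`: the exponent of `x₂` odd, the others even. -/
def hIV {k : Type*} [Field k] (f : R k) : S k := parityPart ![0, 0, 1] f

/-! ### The matrices -/

/-- First syzygies of the Veronese surface; the columns are `W₁, …, W₈`. -/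
def M₂ (k : Type*) [Field k] : Matrix (Fin 6) (Fin 8) (S k) :=
  !![x₀₂, 0, x₀₁, 0, 0, x₀₀, 0, 0;
     -x₁₂, x₀₂, -x₁₁, x₀₁, 0, 0, x₀₀, 0;
     x₂₂, 0, x₁₂, x₀₂, x₀₁, x₀₂, 0, x₀₀;
     0, -x₁₂, 0, -x₁₁, 0, -x₁₁, -x₀₁, 0;
     0, x₂₂, 0, 0, -x₁₁, x₁₂, x₀₂, -x₀₁;
     0, 0, 0, x₂₂, x₁₂, 0, 0, x₀₂]

/-- Second syzygies of the Veronese surface; the columns are `G₁, G₂, G₃`. -/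
def M₃ (k : Type*) [Field k] : Matrix (Fin 8) (Fin 3) (S k) :=
  !![x₀₁, x₀₀, 0;
     -x₁₁, -x₀₁, 0;
     -x₀₂, 0, x₀₀;
     x₁₂, x₀₂, 0;
     -x₂₂, 0, x₀₂;
     0, -x₀₂, -x₀₁;
     0, x₁₂, x₁₁;
     0, -x₂₂, -x₁₂]

/-- The columns are `Y₀₀, Y₀₁, Y₁₀, Y₁₁, Y₁₂, Y₂₀, Y₂₁, Y₂₂`, the lower parts of `V₁, …, V₈`. -/
def Y (k : Type*) [Field k] : Matrix (Fin 3) (Fin 8) (S k) :=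
  (!![x₀₁, -x₀₀, 0;
      x₁₁, -x₀₁, 0;
      x₀₂, 0, -x₀₀;
      x₁₂, 0, -x₀₁;
      x₂₂, 0, -x₀₂;
      0, x₀₂, -x₀₁;
      0, x₁₂, -x₁₁;
      0, x₂₂, -x₁₂]).transpose

/-- The columns are the upper parts of `V₁, …, V₈`. -/
def Vtop {k : Type*} [Field k] (f : R k) : Matrix (Fin 6) (Fin 8) (S k) :=
  (!![0, 0, -x₀₀ * hI f, 0, hIV f, hIII f;
      0, 0, hIV f, 0, -x₁₁ * hI f, -hII f;
      0, x₀₀ * hI f, 0, hIV f, hIII f, 0;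
      x₀₀ * hI f, hIV f, 0, 0, -hII f, -x₂₂ * hI f;
      0, -hIII f, 0, -hII f, -x₂₂ * hI f, 0;
      0, hIV f, hIII f, x₁₁ * hI f, 0, -x₂₂ * hI f;
      hIV f, x₁₁ * hI f, -hII f, 0, 0, 0;
      -hIII f, -hII f, x₂₂ * hI f, 0, 0, 0]).transpose

/-- The columns are `L₁, …, L₆`, the lower parts of `K₁, …, K₆`. -/
def L (k : Type*) [Field k] : Matrix (Fin 8) (Fin 6) (S k) :=
  (!![x₀₂, 0, -x₀₁, 0, 0, x₀₀, 0, 0;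
      x₁₂, x₀₂, -x₁₁, -x₀₁, 0, x₀₁, x₀₀, 0;
      x₂₂, 0, -x₁₂, x₀₂, -x₀₁, 0, 0, x₀₀;
      0, x₁₂, 0, -x₁₁, 0, 0, x₀₁, 0;
      0, x₂₂, 0, 0, -x₁₁, -x₁₂, x₀₂, x₀₁;
      0, 0, 0, x₂₂, -x₁₂, -x₂₂, 0, x₀₂]).transpose

/-- The columns are the upper parts of `K₁, …, K₆`. -/
def Ktop {k : Type*} [Field k] (f : R k) : Matrix (Fin 8) (Fin 6) (S k) :=
  (!![0, 0, 0, x₀₀ * hI f, 0, 0, -hIV f, -hIII f;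
      0, 0, x₀₀ * hI f, 0, -hIII f, -hIV f, x₁₁ * hI f, hII f;
      -x₀₀ * hI f, -hIV f, 0, -hIII f, 0, hIII f, hII f, x₂₂ * hI f;
      0, 0, -hIV f, -x₁₁ * hI f, hII f, x₁₁ * hI f, 0, 0;
      -hIV f, -x₁₁ * hI f, hIII f, hII f, -x₂₂ * hI f, 0, 0, 0;
      hIII f, hII f, 0, 0, 0, -x₂₂ * hI f, 0, 0]).transpose

/-- The lower part of `J`. -/
def J' (k : Type*) [Field k] : Matrix (Fin 6) (Fin 1) (S k) :=
  !![x₁₂ ^ 2 - x₁₁ * x₂₂;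
     -x₀₂ * x₁₂ + x₀₁ * x₂₂;
     x₁₁ * x₀₂ - x₀₁ * x₁₂;
     x₀₂ ^ 2 - x₀₀ * x₂₂;
     -x₀₁ * x₀₂ + x₀₀ * x₁₂;
     x₀₁ ^ 2 - x₀₀ * x₁₁]

/-- The upper part of `J`. -/
def Jtop {k : Type*} [Field k] (f : R k) : Matrix (Fin 3) (Fin 1) (S k) :=
  !![-x₀₀ * x₁₂ * hI f - x₀₀ * hII f - x₀₁ * hIII f - x₀₂ * hIV f;
     x₁₁ * x₀₂ * hI f + x₀₁ * hII f + x₁₁ * hIII f + x₁₂ * hIV f;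
     -x₀₁ * x₂₂ * hI f - x₀₂ * hII f - x₁₂ * hIII f - x₂₂ * hIV f]

/-- `β₁ = [Δ₀₀, …, Δ₂₂, F₀, F₁, F₂]`. -/
def β₁ {k : Type*} [Field k] (f : R k) : Matrix (Fin 1) (Fin 6 ⊕ Fin 3) (S k) :=
  fun _ => Sum.elim (delta k) (F f)

/-- `β₂ = [W'₁, …, W'₈, V₁, …, V₈]`. -/
def β₂ {k : Type*} [Field k] (f : R k) : Matrix (Fin 6 ⊕ Fin 3) (Fin 8 ⊕ Fin 8) (S k) :=
  Matrix.fromBlocks (M₂ k) (Vtop f) 0 (Y k)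

/-- `β₃ = [G'₁, G'₂, G'₃, K₁, …, K₆]`. -/
def β₃ {k : Type*} [Field k] (f : R k) : Matrix (Fin 8 ⊕ Fin 8) (Fin 3 ⊕ Fin 6) (S k) :=
  Matrix.fromBlocks (M₃ k) (Ktop f) 0 (L k)

/-- `β₄ = [J]`. -/
def β₄ {k : Type*} [Field k] (f : R k) : Matrix (Fin 3 ⊕ Fin 6) (Fin 1) (S k) :=
  Matrix.fromRows (Jtop f) (J' k)

/-! ### Minimal graded free resolutions -/

/-- The homogeneous component `S_e`, for an integer `e` (it is `0` for `e < 0`). -/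
def component (k : Type*) [Field k] (e : ℤ) : Submodule k (S k) :=
  if 0 ≤ e then homogeneousSubmodule (Fin 6) k e.toNat else ⊥

/-- The degree `n` component of the graded `S`-module `⨁ i, S(a i)`, where `S(a)_n = S_(a + n)`. -/
def twistComponent (k : Type*) [Field k] {ι : Type*} (a : ι → ℤ) (n : ℤ) :
    Submodule k (ι → S k) :=
  Submodule.pi Set.univ fun i => component k (a i + n)

/-- The matrix `M` is a homomorphism of graded modules (of degree `0`)
`⨁ j, S(b j) → ⨁ i, S(a i)`. -/
def IsGradedMap {k : Type*} [Field k] {ι κ : Type*} [Fintype κ]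
    (a : ι → ℤ) (b : κ → ℤ) (M : Matrix ι κ (S k)) : Prop :=
  ∀ n : ℤ, ∀ v ∈ twistComponent k b n, M.mulVec v ∈ twistComponent k a n

/-- All entries of `M` lie in the irrelevant maximal ideal; in particular no entry is a nonzero
constant. -/
def IsMinimalMatrix {k : Type*} [Field k] {ι κ : Type*} (M : Matrix ι κ (S k)) : Prop :=
  ∀ i j, constantCoeff (M i j) = 0

/-- The natural map `E₀ = S → S / I`, where `E₀` is written as `S¹`. -/
def augmentation {k : Type*} [Field k] (I : Ideal (S k)) : (Fin 1 → S k) →ₗ[S k] (S k ⧸ I) :=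
  I.mkQ ∘ₗ LinearMap.proj 0

/-- `0 → ⨁ S(a₄) → ⨁ S(a₃) → ⨁ S(a₂) → ⨁ S(a₁) → S → S / I → 0`, with the maps given by the
matrices `B₄, B₃, B₂, B₁`, is a minimal graded free resolution of `S / I`. -/
structure IsMinimalGradedFreeResolution {k : Type*} [Field k]
    {ι₁ ι₂ ι₃ ι₄ : Type*} [Fintype ι₁] [Fintype ι₂] [Fintype ι₃] [Fintype ι₄]
    (I : Ideal (S k)) (a₁ : ι₁ → ℤ) (a₂ : ι₂ → ℤ) (a₃ : ι₃ → ℤ) (a₄ : ι₄ → ℤ)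
    (B₁ : Matrix (Fin 1) ι₁ (S k)) (B₂ : Matrix ι₁ ι₂ (S k))
    (B₃ : Matrix ι₂ ι₃ (S k)) (B₄ : Matrix ι₃ ι₄ (S k)) : Prop where
  graded₁ : IsGradedMap (fun _ => 0) a₁ B₁
  graded₂ : IsGradedMap a₁ a₂ B₂
  graded₃ : IsGradedMap a₂ a₃ B₃
  graded₄ : IsGradedMap a₃ a₄ B₄
  surjective : Function.Surjective (augmentation I)
  exact₀ : Function.Exact B₁.mulVecLin (augmentation I)
  exact₁ : Function.Exact B₂.mulVecLin B₁.mulVecLin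
  exact₂ : Function.Exact B₃.mulVecLin B₂.mulVecLin
  exact₃ : Function.Exact B₄.mulVecLin B₃.mulVecLin
  injective : Function.Injective B₄.mulVecLin
  minimal₁ : IsMinimalMatrix B₁
  minimal₂ : IsMinimalMatrix B₂
  minimal₃ : IsMinimalMatrix B₃
  minimal₄ : IsMinimalMatrix B₄

end

end VeroneseCurve

namespace VeroneseCurve

open MvPolynomial

variable {k : Type*} [Field k]

/-! Write R for k[x₀, x₁, x₂], split by parity of degree into R_even and R_odd. The map θ identifies
S modulo the minors with R_even, so R_odd is an S-module, generated by x₀, x₁, x₂. As f has odd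
degree, multiplication by f embeds R_odd into R_even, and the cokernel is S/I_C. The resolution is
the mapping cone of this multiplication: `M₃`, `M₂`, `delta` resolve R_even; `J'`, `L`, `Y` resolve
R_odd; and `F`, `Vtop`, `Ktop`, `Jtop` lift multiplication by f to the two complexes, with the signs
of the cone built in.

The ideal (`homogeneousIdeal_eq`): if G vanishes on σ(C), then θ(G) vanishes on C, so f divides θ(G)
by the Nullstellensatz (`dvd_of_vanishes`). For homogeneous G the cofactor can be taken in R_odd,
hence of the form Σ xᵢ θ(wᵢ), and G - Σ Fᵢ wᵢ lies in ker θ. That kernel is the ideal of the minors,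
because rewriting by minors brings every monomial to the normal form `monomialLift`
(`theta_eq_zero_iff`).

Exactness: a complex of homogeneous matrices is exact once it is exact modulo a variable
(`exact_of_kill`, a graded Nakayama argument). Modulo x₀₀, x₁₁, x₂₂ the matrices are sparse in the
regular sequence x₀₁, x₀₂, x₁₂ and their kernels are found by elimination. The relations among x₀,
x₁, x₂ over S are instead found from the minors (`exists_eq_Y_mulVec`), and injectivity at the left
ends follows from a nonzero minor or entry. A chase through the blocks then gives exactness of the
cone; cancelling f is what makes it work at `β₁`. For minimality, every entry is zero or homogeneous
of positive degree. -/

/-! ### Matrix identities: the two complexes and the comparison maps between them. -/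

theorem M₂_mul_M₃ : M₂ k * M₃ k = 0 := by
  ext1 i j
  rw [Matrix.mul_apply, Matrix.zero_apply]
  fin_cases i <;> fin_cases j <;> simp [M₂, M₃, Fin.sum_univ_succ] <;> ring_nf

theorem Y_mul_L : Y k * L k = 0 := by
  ext1 i j
  rw [Matrix.mul_apply, Matrix.zero_apply]
  fin_cases i <;> fin_cases j <;> simp [Y, L, Fin.sum_univ_succ] <;> ring_nf

theorem L_mul_J' : L k * J' k = 0 := by
  ext1 i j
  rw [Matrix.mul_apply, Matrix.zero_apply]
  fin_cases i <;> fin_cases j <;> simp [L, J', Fin.sum_univ_succ] <;> ring_nf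

set_option maxHeartbeats 2000000 in
-- The square comparing the two complexes anticommutes, which is the off-diagonal block of `β₂ * β₃
-- = 0`. It is a formal identity in the four parity parts, so no condition on f is needed.
theorem M₂_mul_Ktop_add_Vtop_mul_L (f : R k) : M₂ k * Ktop f + Vtop f * L k = 0 := by
  ext1 i j
  rw [Matrix.add_apply, Matrix.mul_apply, Matrix.mul_apply, Matrix.zero_apply]
  fin_cases i <;> fin_cases j <;>
    simp [M₂, Ktop, Vtop, L, Fin.sum_univ_succ] <;> ring_nf

theorem M₃_mul_Jtop_add_Ktop_mul_J' (f : R k) : M₃ k * Jtop f + Ktop f * J' k = 0 := by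
  ext1 i j
  rw [Matrix.add_apply, Matrix.mul_apply, Matrix.mul_apply, Matrix.zero_apply]
  fin_cases i <;> fin_cases j <;>
    simp [M₃, Jtop, Ktop, J', Fin.sum_univ_succ] <;> ring_nf

/-! ### Reduction modulo a variable -/

section Kill

variable {σ : Type*} [DecidableEq σ]

/-- The substitution `X j ↦ 0`. -/
noncomputable def kill (k : Type*) [Field k] (j : σ) : MvPolynomial σ k →ₐ[k] MvPolynomial σ k :=
  aeval (Function.update X j 0)

@[simp] theorem kill_X_self (j : σ) : kill k j (X j) = 0 := by simp [kill]

theorem kill_X_of_ne {i j : σ} (h : i ≠ j) : kill k j (X i) = X i := by simp [kill, h]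

theorem X_dvd_sub_kill (j : σ) (p : MvPolynomial σ k) : X j ∣ p - kill k j p := by
  induction p using MvPolynomial.induction_on with
  | C a => simp [kill]
  | add p q hp hq =>
    rw [map_add, add_sub_add_comm]
    exact dvd_add hp hq
  | mul_X p i hp =>
    have h : X j ∣ (X i - kill k j (X i) : MvPolynomial σ k) := by
      by_cases hij : i = j
      · simp [hij]
      · simp [kill_X_of_ne hij]
    rw [map_mul, show p * X i - kill k j p * kill k j (X i) =
      (p - kill k j p) * X i + kill k j p * (X i - kill k j (X i)) by ring]
    exact dvd_add (hp.mul_right _) (h.mul_left _)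

theorem kill_kill (j : σ) (p : MvPolynomial σ k) : kill k j (kill k j p) = kill k j p := by
  obtain ⟨q, hq⟩ := X_dvd_sub_kill j p
  have := congrArg (kill k j) hq
  rw [map_sub, map_mul, kill_X_self, zero_mul] at this
  exact (sub_eq_zero.1 this).symm

theorem isHomogeneous_kill (j : σ) {p : MvPolynomial σ k} {n : ℕ} (hp : p.IsHomogeneous n) :
    (kill k j p).IsHomogeneous n := by
  have := hp.aeval (Function.update X j 0 : σ → MvPolynomial σ k) (n := 1) (fun i => by
    by_cases h : i = j
    · subst h; simpa using isHomogeneous_zero σ k 1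
    · simpa [h] using isHomogeneous_X k i)
  rwa [one_mul] at this

/-- The component of degree `n - p`, which is zero if `n < p`. -/
noncomputable def shiftedComponent {σ : Type*} (p n : ℕ) (b : MvPolynomial σ k) : MvPolynomial σ k :=
  if p ≤ n then homogeneousComponent (n - p) b else 0

theorem homogeneousComponent_mul_of_isHomogeneous {σ : Type*} {p : ℕ} {a : MvPolynomial σ k}
    (ha : a.IsHomogeneous p) (n : ℕ) (b : MvPolynomial σ k) :
    homogeneousComponent n (a * b) = a * shiftedComponent p n b := by
  -- Only the component of b in degree n - p can contribute to degree n.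
  have key : ∀ i, homogeneousComponent n (a * homogeneousComponent i b) =
      if p + i = n then a * homogeneousComponent i b else 0 := fun i => by
    rw [homogeneousComponent_of_mem
      ((mem_homogeneousSubmodule _ _).2 (ha.mul (homogeneousComponent_isHomogeneous i b)))]
    simp only [eq_comm]
  conv_lhs => rw [← sum_homogeneousComponent b, Finset.mul_sum, map_sum]
  simp_rw [key]
  unfold shiftedComponent
  split_ifs with h
  · rw [Finset.sum_eq_single (n - p)]
    · rw [if_pos (by omega)]
    · intro i _ hi
      rw [if_neg (by omega)]
    · intro hi
      rw [homogeneousComponent_eq_zero _ _ (by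
        have : b.totalDegree + p < n := by simpa using hi
        omega)]
      simp
  · rw [mul_zero]
    exact Finset.sum_eq_zero fun i _ => if_neg (by omega)

theorem homogeneousComponent_mulVec {σ : Type*} {ι κ : Type*} [Fintype κ] {p : ℕ}
    {M : Matrix ι κ (MvPolynomial σ k)} (hM : ∀ i j, (M i j).IsHomogeneous p) (n : ℕ)
    (v : κ → MvPolynomial σ k) (i : ι) :
    homogeneousComponent n (M.mulVec v i) = M.mulVec (fun j => shiftedComponent p n (v j)) i := by
  simp only [Matrix.mulVec, dotProduct, map_sum]
  exact Finset.sum_congr rfl fun j _ => homogeneousComponent_mul_of_isHomogeneous (hM i j) n _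

/-- A complex of matrices with homogeneous entries is exact if it is exact modulo a variable. -/
theorem exact_of_kill {ι κ μ : Type*} [Fintype κ] [Fintype μ] (j : σ) {p q : ℕ}
    {N : Matrix ι κ (MvPolynomial σ k)} {M : Matrix κ μ (MvPolynomial σ k)}
    (hN : ∀ i j, (N i j).IsHomogeneous q) (hM : ∀ i j, (M i j).IsHomogeneous p)
    (hNM : N * M = 0)
    (h : ∀ v, (N.map (kill k j)).mulVec v = 0 → ∃ w, v = (M.map (kill k j)).mulVec w)
    (v : κ → MvPolynomial σ k) (hv : N.mulVec v = 0) : ∃ w, v = M.mulVec w := by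
  -- A homogeneous kernel vector is in the image up to X j times a kernel vector of degree one less;
  -- in degree 0 the latter vanishes, so induction on the degree finishes.
  have step : ∀ n, ∀ v : κ → MvPolynomial σ k, (∀ i, (v i).IsHomogeneous n) → N.mulVec v = 0 →
      ∃ (w : μ → MvPolynomial σ k) (v' : κ → MvPolynomial σ k), (v = M.mulVec w + (X j : MvPolynomial σ k) • fun i => shiftedComponent 1 n (v' i)) ∧
        N.mulVec (fun i => shiftedComponent 1 n (v' i)) = 0 := by
    intro n v hvn hv
    obtain ⟨w, hw⟩ := h (fun i => kill k j (v i)) (by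
      funext i
      have := congrArg (kill k j) (congrFun hv i)
      simpa [Matrix.mulVec, dotProduct] using this)
    have hdvd : ∀ i, X j ∣ v i - M.mulVec w i := by
      intro i
      have h1 : kill k j (v i) = kill k j (M.mulVec w i) := by
        have := congrArg (kill k j) (congrFun hw i)
        simpa [Matrix.mulVec, dotProduct, kill_kill] using this
      have := X_dvd_sub_kill j (v i - M.mulVec w i)
      rwa [map_sub, h1, sub_self, sub_zero] at this
    choose v' hv' using hdvd
    -- The lift w and the quotient v' need not be homogeneous; taking the degree n component of the
    -- equation replaces both by homogeneous parts.
    have heq : v = M.mulVec (fun i => shiftedComponent p n (w i)) +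
        (X j : MvPolynomial σ k) • fun i => shiftedComponent 1 n (v' i) := by
      funext i
      have := congrArg (homogeneousComponent n) (sub_eq_iff_eq_add'.1 (hv' i))
      rwa [homogeneousComponent_eq_self (hvn i), map_add, homogeneousComponent_mulVec hM,
        homogeneousComponent_mul_of_isHomogeneous (isHomogeneous_X k j)] at this
    refine ⟨_, v', heq, ?_⟩
    rw [heq, Matrix.mulVec_add, Matrix.mulVec_mulVec, hNM, Matrix.zero_mulVec, zero_add,
      Matrix.mulVec_smul] at hv
    exact (smul_eq_zero.1 hv).resolve_left (X_ne_zero j)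
  have main : ∀ n, ∀ v : κ → MvPolynomial σ k, (∀ i, (v i).IsHomogeneous n) → N.mulVec v = 0 →
      ∃ w, v = M.mulVec w := by
    intro n
    induction n with
    | zero =>
      intro v hvn hv
      obtain ⟨w, v', h1, -⟩ := step 0 v hvn hv
      refine ⟨w, h1.trans ?_⟩
      funext i
      simp [shiftedComponent]
    | succ n ih =>
      intro v hvn hv
      obtain ⟨w, v', h1, h2⟩ := step (n + 1) v hvn hv
      obtain ⟨w', hw'⟩ := ih _ (fun i => by
        simpa [shiftedComponent] using homogeneousComponent_isHomogeneous n (v' i)) h2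
      exact ⟨w + (X j : MvPolynomial σ k) • w', by
        rw [Matrix.mulVec_add, Matrix.mulVec_smul, ← hw']; exact h1⟩
  -- As N is homogeneous of degree q, the degree q + n component of N v is N applied to the degree n
  -- component of v.
  have hcomp : ∀ n, ∃ w, (fun i => homogeneousComponent n (v i)) = M.mulVec w := by
    intro n
    refine main n _ (fun i => homogeneousComponent_isHomogeneous n (v i)) ?_
    funext i
    have h1 := homogeneousComponent_mulVec hN (q + n) v i
    rw [hv] at h1
    simpa [shiftedComponent] using h1.symm
  choose w hw using hcomp
  obtain ⟨D, hD⟩ : ∃ D, ∀ i, (v i).totalDegree ≤ D :=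
    ⟨Finset.univ.sup fun i => (v i).totalDegree,
      fun i => Finset.le_sup (f := fun i => (v i).totalDegree) (Finset.mem_univ i)⟩
  refine ⟨∑ n ∈ Finset.range (D + 1), w n, ?_⟩
  rw [Matrix.mulVec_sum]
  simp_rw [← hw]
  funext i
  rw [Finset.sum_apply]
  conv_lhs => rw [← sum_homogeneousComponent (v i)]
  refine Finset.sum_subset (Finset.range_mono (by have := hD i; omega)) fun n _ hn => ?_
  exact homogeneousComponent_eq_zero _ _ (by
    have : (v i).totalDegree + 1 ≤ n := by simpa using hn
    omega)

end Kill

/-! ### Regular sequences of variables. -/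

section Regular

variable {σ : Type*}

theorem eq_X_mul_of_X_mul_eq {i j : σ} (h : i ≠ j) {p r : MvPolynomial σ k}
    (e : X j * p = X i * r) : ∃ q, p = X i * q := by
  rcases X_dvd_mul_iff.1 (Dvd.intro _ e.symm) with h' | h'
  · exact absurd (X_dvd_X.1 h') h
  · exact h'

/-- Setting X i to zero leaves a relation between two variables, and p differs from its reduction by
a multiple of X i. -/
theorem eq_X_mul_add_of_X_mul_eq [DecidableEq σ] {i j l : σ} (hi : i ≠ j) (hil : i ≠ l) (hjl : j ≠ l)
    {p r s : MvPolynomial σ k} (e : X l * p = X i * r + X j * s) :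
    ∃ r' s', p = X i * r' + X j * s' := by
  have h := congrArg (kill k i) e
  rw [map_mul, map_add, map_mul, map_mul, kill_X_self, kill_X_of_ne hil.symm, kill_X_of_ne hi.symm,
    zero_mul, zero_add] at h
  obtain ⟨s', hs'⟩ := eq_X_mul_of_X_mul_eq hjl h
  obtain ⟨r', hr'⟩ := X_dvd_sub_kill i p
  exact ⟨r', s', by rw [← hs', ← hr']; ring⟩

theorem eq_X_mul_and_eq_X_mul {i j : σ} (h : i ≠ j) {p r : MvPolynomial σ k}
    (e : X j * p = X i * r) : ∃ q, p = X i * q ∧ r = X j * q := by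
  obtain ⟨q, hq⟩ := eq_X_mul_of_X_mul_eq h e
  refine ⟨q, hq, mul_left_cancel₀ (X_ne_zero i) ?_⟩
  rw [← e, hq]; ring

end Regular

/-- A complex of matrices with homogeneous entries is exact if it is exact modulo
`x₀₀, x₁₁, x₂₂`. -/
theorem exact_of_kill_diagonal {ι κ μ : Type*} [Fintype κ] [Fintype μ] {p q : ℕ}
    {N : Matrix ι κ (S k)} {M : Matrix κ μ (S k)}
    (hN : ∀ i j, (N i j).IsHomogeneous q) (hM : ∀ i j, (M i j).IsHomogeneous p)
    (hNM : N * M = 0)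
    (h : ∀ v, (((N.map (kill k 0)).map (kill k 3)).map (kill k 5)).mulVec v = 0 →
      ∃ w, v = (((M.map (kill k 0)).map (kill k 3)).map (kill k 5)).mulVec w)
    (v : κ → S k) (hv : N.mulVec v = 0) : ∃ w, v = M.mulVec w := by
  have h0 : N.map (kill k 0) * M.map (kill k 0) = 0 := by
    rw [← Matrix.map_mul, hNM, Matrix.map_zero _ (map_zero _)]
  have h3 : (N.map (kill k 0)).map (kill k 3) * (M.map (kill k 0)).map (kill k 3) = 0 := by
    rw [← Matrix.map_mul, h0, Matrix.map_zero _ (map_zero _)]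
  have hN0 := fun i j => isHomogeneous_kill (0 : Fin 6) (hN i j)
  have hM0 := fun i j => isHomogeneous_kill (0 : Fin 6) (hM i j)
  exact exact_of_kill 0 hN hM hNM
    (exact_of_kill 3 hN0 hM0 h0
      (exact_of_kill 5 (fun i j => isHomogeneous_kill 3 (hN0 i j)) (fun i j => isHomogeneous_kill 3 (hM0 i j)) h3 h)) v hv

/-! ### Degrees of the entries that do not depend on f. -/

section Entries

theorem isHomogeneous_X_neg {σ : Type*} (i : σ) : (-X i : MvPolynomial σ k).IsHomogeneous 1 :=
  (isHomogeneous_X k i).neg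

theorem isHomogeneous_M₂ (i : Fin 6) (j : Fin 8) : (M₂ k i j).IsHomogeneous 1 := by
  fin_cases i <;> fin_cases j <;>
    simp [M₂, isHomogeneous_X, isHomogeneous_X_neg, isHomogeneous_zero]

theorem isHomogeneous_M₃ (i : Fin 8) (j : Fin 3) : (M₃ k i j).IsHomogeneous 1 := by
  fin_cases i <;> fin_cases j <;>
    simp [M₃, isHomogeneous_X, isHomogeneous_X_neg, isHomogeneous_zero]

theorem isHomogeneous_Y (i : Fin 3) (j : Fin 8) : (Y k i j).IsHomogeneous 1 := by
  fin_cases i <;> fin_cases j <;>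
    simp [Y, isHomogeneous_X, isHomogeneous_X_neg, isHomogeneous_zero]

theorem isHomogeneous_L (i : Fin 8) (j : Fin 6) : (L k i j).IsHomogeneous 1 := by
  fin_cases i <;> fin_cases j <;>
    simp [L, isHomogeneous_X, isHomogeneous_X_neg, isHomogeneous_zero]

theorem isHomogeneous_X_mul_X {σ : Type*} (i j : σ) :
    (X i * X j : MvPolynomial σ k).IsHomogeneous 2 :=
  (isHomogeneous_X k i).mul (isHomogeneous_X k j)

theorem isHomogeneous_X_sq {σ : Type*} (i : σ) : (X i ^ 2 : MvPolynomial σ k).IsHomogeneous 2 :=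
  isHomogeneous_X_pow i 2

theorem isHomogeneous_J' (i : Fin 6) (j : Fin 1) : (J' k i j).IsHomogeneous 2 := by
  fin_cases i <;> fin_cases j <;>
    simp [J', IsHomogeneous.sub, IsHomogeneous.add, IsHomogeneous.neg, isHomogeneous_X_mul_X,
      isHomogeneous_X_sq]

theorem isHomogeneous_delta (i : Fin 6) : (delta k i).IsHomogeneous 2 := by
  fin_cases i <;> simp [delta, IsHomogeneous.sub, isHomogeneous_X_mul_X, isHomogeneous_X_sq]

theorem delta_mul_M₂ : Matrix.replicateRow (Fin 1) (delta k) * M₂ k = 0 := by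
  ext1 i j
  rw [Matrix.mul_apply, Matrix.zero_apply]
  fin_cases j <;> simp [M₂, delta, Fin.sum_univ_succ] <;> ring_nf

end Entries

/-! ### Linear systems over a regular sequence a, b, c, modelled on x₀₁, x₀₂, x₁₂. -/

section Elimination

/-- `a, b` is a regular sequence, up to the condition that `a` is a nonzerodivisor. -/
def IsRegularPair {T : Type*} [CommRing T] (a b : T) : Prop :=
  ∀ p r, b * p = a * r → ∃ q, p = a * q ∧ r = b * q

/-- `c` is a nonzerodivisor modulo `a, b`. -/
def IsRegularTriple {T : Type*} [CommRing T] (a b c : T) : Prop :=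
  ∀ p r s, c * p = a * r + b * s → ∃ r' s', p = a * r' + b * s'

variable {T : Type*} [CommRing T] {a b c : T}

/-- Modulo the diagonal variables the six minors are, up to sign, the quadratic monomials in a, b,
c. Their syzygies are found by peeling off terms: first those outside (a, b), then those outside
(a), and finally a is cancelled. -/
theorem exists_of_minors_relation [IsDomain T] (ha : a ≠ 0) (hab : IsRegularPair a b)
    (habc : IsRegularTriple a b c) {u₀ u₁ u₂ u₃ u₄ u₅ : T}
    (e : -(c ^ 2 * u₀) - c * b * u₁ + a * c * u₂ - b ^ 2 * u₃ - b * a * u₄ - a ^ 2 * u₅ = 0) :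
    ∃ p s q r y z t g : T, u₀ = a * q + b * p ∧ u₁ + c * p = a * r + b * s ∧
      u₂ - b * r - c * q = a * y + b * z ∧ u₃ + c * s = a * t ∧
      c * z - u₄ - b * t = a * g ∧ u₅ - c * y = b * g := by
  -- Modulo (a, b) only c²u₀ survives; the two factors c are removed one at a time.
  obtain ⟨q', p', h0'⟩ := habc (c * u₀) (c * u₂ - b * u₄ - a * u₅) (- c * u₁ - b * u₃)
    (by linear_combination -e)
  obtain ⟨q, p, h0⟩ := habc _ _ _ h0'
  obtain ⟨r', h1', -⟩ := hab (c * (u₁ + c * p) + b * u₃)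
    (c * u₂ - b * u₄ - a * u₅ - c ^ 2 * q) (by linear_combination -e - c ^ 2 * h0)
  obtain ⟨r, s, h1⟩ := habc (u₁ + c * p) r' (- u₃) (by linear_combination h1')
  obtain ⟨t', h3', -⟩ := hab (b * (u₃ + c * s))
    (c * u₂ - b * u₄ - a * u₅ - c ^ 2 * q - b * c * r)
    (by linear_combination -e - c ^ 2 * h0 - b * c * h1)
  obtain ⟨t, h3, -⟩ := hab _ _ h3'
  have e2 : c * (u₂ - b * r - c * q) = a * u₅ + b * (u₄ + b * t) :=
    mul_left_cancel₀ ha (by linear_combination e + c ^ 2 * h0 + b * c * h1 + b ^ 2 * h3)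
  obtain ⟨y, z, h2⟩ := habc _ _ _ e2
  obtain ⟨g, h4, h5⟩ := hab (c * z - u₄ - b * t) (u₅ - c * y) (by linear_combination e2 - c * h2)
  exact ⟨p, s, q, r, y, z, t, g, h0, h1, h2, h3, h4, h5⟩

theorem exists_of_Y_relations (hbc : IsRegularPair b c) (hca : IsRegularPair c a)
    (hbca : IsRegularTriple b c a) (hacb : IsRegularTriple a c b)
    {u₀ u₁ u₂ u₃ u₄ u₅ u₆ u₇ : T}
    (e0 : a * u₀ + b * u₂ + c * u₃ = 0) (e1 : -(a * u₁) + b * u₅ + c * u₆ = 0)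
    (e2 : -(a * u₃) - b * u₄ - a * u₅ - c * u₇ = 0) :
    ∃ p q s x y g e h r : T, u₀ = b * p + c * q ∧ u₃ + a * q = b * s ∧
      -(u₂ + a * p) = c * s ∧ b * s + u₅ - a * q = b * x + c * y ∧
      u₇ + a * y = b * g ∧ -(u₄ + a * x) = c * g ∧ x - s = a * e + c * h ∧
      u₁ - b * q - b ^ 2 * e = c * r ∧ u₆ + b * y + b ^ 2 * h = a * r := by
  obtain ⟨p, q, h0⟩ := hbca u₀ (-u₂) (-u₃) (by linear_combination e0)
  obtain ⟨s, h3, h2⟩ := hbc (u₃ + a * q) (-(u₂ + a * p)) (by linear_combination e0 - a * h0)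
  have e2' : a * (b * s + u₅ - a * q) = b * (- u₄) + c * (- u₇) := by
    linear_combination -e2 - a * h3
  obtain ⟨x, y, h5⟩ := hbca _ _ _ e2'
  obtain ⟨g, h7, h4⟩ := hbc (u₇ + a * y) (-(u₄ + a * x)) (by linear_combination e2' - a * h5)
  -- Eliminating u₅ from the second equation puts b²(x - s) into (a, c), and b is removed twice.
  -- This compares the two parameters s and x, which came from different equations.
  obtain ⟨e', h', hx'⟩ := hacb (b * (x - s)) (u₁ - b * q) (- u₆ - b * y)
    (by linear_combination e1 - b * h5)
  obtain ⟨e, h, hx⟩ := hacb _ _ _ hx'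
  obtain ⟨r, h1, h6⟩ := hca (u₁ - b * q - b ^ 2 * e) (u₆ + b * y + b ^ 2 * h)
    (by linear_combination -e1 + b * h5 + b ^ 2 * hx)
  exact ⟨p, q, s, x, y, g, e, h, r, h0, h3, h2, h5, h7, h4, hx, h1, h6⟩

end Elimination

theorem isRegularPair_X {σ : Type*} {i j : σ} (h : i ≠ j) :
    IsRegularPair (X i : MvPolynomial σ k) (X j) := fun _ _ e => eq_X_mul_and_eq_X_mul h e

theorem isRegularTriple_X {σ : Type*} [DecidableEq σ] {i j l : σ} (hij : i ≠ j) (hil : i ≠ l)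
    (hjl : j ≠ l) : IsRegularTriple (X i : MvPolynomial σ k) (X j) (X l) :=
  fun _ _ _ e => eq_X_mul_add_of_X_mul_eq hij hil hjl e

/-! ### Exactness of the resolutions of the even and the odd part. -/

section Exactness

theorem exists_eq_M₂_mulVec (v : Fin 6 → S k)
    (hv : (Matrix.replicateRow (Fin 1) (delta k)).mulVec v = 0) : ∃ w, v = (M₂ k).mulVec w := by
  refine exact_of_kill_diagonal (N := Matrix.replicateRow (Fin 1) (delta k))
    (fun _ => isHomogeneous_delta) isHomogeneous_M₂ delta_mul_M₂
    (fun u hu => ?_) v hv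
  have e := congrFun hu 0
  simp [delta, Matrix.mulVec, dotProduct, Fin.sum_univ_succ, kill_X_of_ne] at e
  obtain ⟨p, s, q, r, y, z, t, g, h0, h1, h2, h3, h4, h5⟩ :=
    exists_of_minors_relation (X_ne_zero 1) (isRegularPair_X (by decide))
      (isRegularTriple_X (by decide) (by decide) (by decide))
      (show -(X 4 ^ 2 * u 0) - X 4 * X 2 * u 1 + X 1 * X 4 * u 2 - X 2 ^ 2 * u 3 -
        X 2 * X 1 * u 4 - X 1 ^ 2 * u 5 = 0 by linear_combination e)
  refine ⟨![p, s, q, r, y, z, -t, g], ?_⟩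
  funext i
  fin_cases i <;> simp [M₂, Matrix.mulVec, dotProduct, Fin.sum_univ_succ, kill_X_of_ne]
  · linear_combination h0
  · linear_combination h1
  · linear_combination h2
  · linear_combination h3
  · linear_combination -h4
  · linear_combination h5

theorem exists_eq_M₃_mulVec (v : Fin 8 → S k) (hv : (M₂ k).mulVec v = 0) :
    ∃ w, v = (M₃ k).mulVec w := by
  refine exact_of_kill_diagonal isHomogeneous_M₂ isHomogeneous_M₃ M₂_mul_M₃
    (fun u hu => ?_) v hv
  have e0 := congrFun hu 0
  have e1 := congrFun hu 1
  have e2 := congrFun hu 2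
  have e3 := congrFun hu 3
  have e5 := congrFun hu 5
  simp [M₂, Matrix.mulVec, dotProduct, Fin.sum_univ_succ, kill_X_of_ne] at e0 e1 e2 e3 e5
  -- Rows 0, 3 and 5 reduce to two-term relations, each solved by one parameter; rows 1 and 2 then
  -- determine the remaining coordinates.
  obtain ⟨q, h0, h2⟩ : ∃ q, u 0 = X 1 * q ∧ - u 2 = X 2 * q :=
    eq_X_mul_and_eq_X_mul (by decide) (by linear_combination e0)
  obtain ⟨s, h1, h6⟩ : ∃ s, u 1 = X 1 * s ∧ - u 6 = X 4 * s :=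
    eq_X_mul_and_eq_X_mul (by decide) (by linear_combination -e3)
  obtain ⟨t, h4, h7⟩ : ∃ t, u 4 = X 2 * t ∧ - u 7 = X 4 * t :=
    eq_X_mul_and_eq_X_mul (by decide) (by linear_combination e5)
  have h3 : u 3 = X 4 * q - X 2 * s :=
    mul_left_cancel₀ (X_ne_zero 1) (by linear_combination e1 + X 4 * h0 - X 2 * h1)
  have h5 : u 5 = X 2 * s - X 1 * t :=
    mul_left_cancel₀ (X_ne_zero 2)
      (by linear_combination e2 + X 4 * h2 - X 2 * h3 - X 1 * h4)
  refine ⟨![q, -s, t], ?_⟩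
  funext i
  fin_cases i <;> simp [M₃, Matrix.mulVec, dotProduct, Fin.sum_univ_succ, kill_X_of_ne]
  · linear_combination h0
  · linear_combination h1
  · linear_combination -h2
  · linear_combination h3
  · linear_combination h4
  · linear_combination h5
  · linear_combination -h6
  · linear_combination -h7

/-- The first two rows involve only two unknowns, with determinant x₀₀x₁₁ - x₀₁² ≠ 0; the third row
then gives the last unknown. -/
theorem M₃_mulVec_injective (v : Fin 3 → S k) (hv : (M₃ k).mulVec v = 0) : v = 0 := by
  have e0 := congrFun hv 0
  have e1 := congrFun hv 1
  have e2 := congrFun hv 2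
  simp [M₃, Matrix.mulVec, dotProduct, Fin.sum_univ_succ] at e0 e1 e2
  have hd : (X 0 * X 3 - X 1 ^ 2 : S k) ≠ 0 := by
    intro h
    have := congrArg (kill k 1) h
    simp [kill_X_of_ne] at this
  have h0 : v 0 = 0 := (mul_eq_zero.1 (show (X 0 * X 3 - X 1 ^ 2) * v 0 = 0 by
    linear_combination -X 1 * e0 - X 0 * e1)).resolve_left hd
  have h1 : v 1 = 0 := (mul_eq_zero.1 (show X 0 * v 1 = 0 by
    linear_combination e0 - X 1 * h0)).resolve_left (X_ne_zero 0)
  have h2 : v 2 = 0 := (mul_eq_zero.1 (show X 0 * v 2 = 0 by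
    linear_combination e2 + X 2 * h0)).resolve_left (X_ne_zero 0)
  funext i
  fin_cases i <;> assumption

theorem exists_eq_L_mulVec (v : Fin 8 → S k) (hv : (Y k).mulVec v = 0) :
    ∃ w, v = (L k).mulVec w := by
  refine exact_of_kill_diagonal isHomogeneous_Y isHomogeneous_L Y_mul_L
    (fun u hu => ?_) v hv
  have e0 := congrFun hu 0
  have e1 := congrFun hu 1
  have e2 := congrFun hu 2
  simp [Y, Matrix.mulVec, dotProduct, Fin.sum_univ_succ, kill_X_of_ne] at e0 e1 e2
  obtain ⟨p, q, s, x, y, g, e, h, r, h0, h3, h2, h5, h7, h4, hx, h1, h6⟩ :=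
    exists_of_Y_relations (isRegularPair_X (by decide)) (isRegularPair_X (by decide))
      (isRegularTriple_X (by decide) (by decide) (by decide))
      (isRegularTriple_X (by decide) (by decide) (by decide))
      (show X 1 * u 0 + X 2 * u 2 + X 4 * u 3 = 0 by linear_combination e0)
      (show -(X 1 * u 1) + X 2 * u 5 + X 4 * u 6 = 0 by linear_combination e1)
      (show -(X 1 * u 3) - X 2 * u 4 - X 1 * u 5 - X 4 * u 7 = 0 by linear_combination e2)
  -- The mismatch x - s = x₀₁e + x₁₂h is absorbed here: e by moving p, q, s without changing u₀, u₂,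
  -- u₃, and h by moving y and g.
  refine ⟨![p - X 4 * e, q + X 2 * e, s + X 1 * e, r, -(X 2 * h + y), g + X 1 * h], ?_⟩
  funext i
  fin_cases i <;> simp [L, Matrix.mulVec, dotProduct, Fin.sum_univ_succ, kill_X_of_ne]
  · linear_combination h0
  · linear_combination h1
  · linear_combination -h2
  · linear_combination h3
  · linear_combination -h4 - X 1 * hx
  · linear_combination h5 + X 2 * hx
  · linear_combination h6
  · linear_combination h7

theorem exists_eq_J'_mulVec (v : Fin 6 → S k) (hv : (L k).mulVec v = 0) :
    ∃ w, v = (J' k).mulVec w := by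
  refine exact_of_kill_diagonal isHomogeneous_L isHomogeneous_J' L_mul_J'
    (fun u hu => ?_) v hv
  have e0 := congrFun hu 0
  have e1 := congrFun hu 1
  have e2 := congrFun hu 2
  have e3 := congrFun hu 3
  have e4 := congrFun hu 4
  have e6 := congrFun hu 6
  simp [L, Matrix.mulVec, dotProduct, Fin.sum_univ_succ, kill_X_of_ne] at e0 e1 e2 e3 e4 e6
  obtain ⟨t, h0, h1⟩ : ∃ t, u 0 = X 4 * t ∧ - u 1 = X 2 * t :=
    eq_X_mul_and_eq_X_mul (by decide) (by linear_combination e0)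
  -- The first row gives only one factor x₁₂ of u₀; the second row shows that t has another, so u₀
  -- is x₁₂² times the parameter s.
  obtain ⟨s', hs'⟩ : ∃ s', X 2 * t = X 4 * s' :=
    eq_X_mul_of_X_mul_eq (j := 2) (by decide) (r := u 3) (by linear_combination -e1 - X 2 * h1)
  obtain ⟨s, hs⟩ := eq_X_mul_of_X_mul_eq (by decide) hs'
  have h3 : u 3 = X 2 ^ 2 * s :=
    mul_left_cancel₀ (X_ne_zero 4) (by linear_combination e1 + X 2 * h1 + X 2 ^ 2 * hs)
  have h2 : u 2 = - (X 1 * X 4 * s) :=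
    mul_left_cancel₀ (X_ne_zero 4) (by linear_combination -e2 - X 1 * h0 - X 1 * X 4 * hs)
  have h4 : u 4 = - (X 1 * X 2 * s) :=
    mul_left_cancel₀ (X_ne_zero 2) (by linear_combination e6 - X 1 * h3)
  have h5 : u 5 = X 1 ^ 2 * s :=
    mul_left_cancel₀ (X_ne_zero 4) (by linear_combination -e4 - X 1 * h2)
  refine ⟨![s], ?_⟩
  funext i
  fin_cases i <;> simp [J', Matrix.mulVec, dotProduct, kill_X_of_ne]
  · linear_combination h0 + X 4 * hs
  · linear_combination -h1 - X 2 * hs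
  · linear_combination h2
  · linear_combination h3
  · linear_combination h4
  · linear_combination h5

theorem J'_mulVec_injective (v : Fin 1 → S k) (hv : (J' k).mulVec v = 0) : v = 0 := by
  have e := congrFun hv 0
  simp [J', Matrix.mulVec, dotProduct] at e
  have hd : (X 4 ^ 2 - X 3 * X 5 : S k) ≠ 0 := by
    intro h
    have := congrArg (kill k 3) h
    simp [kill_X_of_ne] at this
  funext i
  fin_cases i
  exact e.resolve_left hd

end Exactness

/-! ### The lift is a section of θ on forms of even degree. -/

section Lift

theorem evenLift_eq_sum {g : R k} {s : Finset (Fin 3 →₀ ℕ)} (hs : g.support ⊆ s) :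
    evenLift g = ∑ e ∈ s, C (g.coeff e) * monomialLift k e :=
  Finset.sum_subset hs fun e _ he => by rw [notMem_support_iff.1 he, C_0, zero_mul]

/-- The lift as an additive map. -/
noncomputable def evenLiftHom (k : Type*) [Field k] : R k →+ S k where
  toFun := evenLift
  map_zero' := by simp [evenLift]
  map_add' g h := by
    classical
    rw [evenLift_eq_sum (support_add (p := g) (q := h)),
      evenLift_eq_sum (Finset.subset_union_left (s₁ := g.support) (s₂ := h.support)),
      evenLift_eq_sum (Finset.subset_union_right (s₁ := g.support) (s₂ := h.support)),
      ← Finset.sum_add_distrib]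
    exact Finset.sum_congr rfl fun e _ => by rw [coeff_add, C_add, add_mul]

theorem evenLift_monomial (e : Fin 3 →₀ ℕ) (a : k) :
    evenLift (monomial e a) = C a * monomialLift k e := by
  classical
  rw [evenLift_eq_sum (s := {e}) support_monomial_subset, Finset.sum_singleton, coeff_monomial,
    if_pos rfl]

theorem evenLift_add (g h : R k) : evenLift (g + h) = evenLift g + evenLift h :=
  map_add (evenLiftHom k) g h

theorem evenLift_sum {ι : Type*} (s : Finset ι) (g : ι → R k) :
    evenLift (∑ i ∈ s, g i) = ∑ i ∈ s, evenLift (g i) :=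
  map_sum (evenLiftHom k) g s

theorem evenLift_X_mul (n : Fin 3) (f : R k) :
    evenLift (X n * f) =
      ∑ e ∈ f.support, C (f.coeff e) * monomialLift k (Finsupp.single n 1 + e) := by
  conv_lhs => rw [← support_sum_monomial_coeff f, Finset.mul_sum, evenLift_sum]
  refine Finset.sum_congr rfl fun e _ => ?_
  rw [X, monomial_mul, one_mul, evenLift_monomial]

section Parity

variable {e : Fin 3 →₀ ℕ} {a b c : ℕ}

theorem monomialLift_even (h₀ : e 0 = 2 * a) (h₁ : e 1 = 2 * b) (h₂ : e 2 = 2 * c) :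
    monomialLift k e = X 0 ^ a * X 3 ^ b * X 5 ^ c := by
  simp [monomialLift, h₀, h₁, h₂, ← Nat.not_even_iff_odd]

theorem monomialLift_x₁₂ (h₀ : e 0 = 2 * a) (h₁ : e 1 = 2 * b + 1) (h₂ : e 2 = 2 * c + 1) :
    monomialLift k e = X 0 ^ a * X 3 ^ b * X 5 ^ c * X 4 := by
  have hb : (2 * b + 1) / 2 = b := by omega
  have hc : (2 * c + 1) / 2 = c := by omega
  simp [monomialLift, h₀, h₁, h₂, hb, hc]

theorem monomialLift_x₀₂ (h₀ : e 0 = 2 * a + 1) (h₁ : e 1 = 2 * b) (h₂ : e 2 = 2 * c + 1) :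
    monomialLift k e = X 0 ^ a * X 3 ^ b * X 5 ^ c * X 2 := by
  have ha : (2 * a + 1) / 2 = a := by omega
  have hc : (2 * c + 1) / 2 = c := by omega
  simp [monomialLift, h₀, h₁, h₂, ha, hc]

theorem monomialLift_x₀₁ (h₀ : e 0 = 2 * a + 1) (h₁ : e 1 = 2 * b + 1) (h₂ : e 2 = 2 * c) :
    monomialLift k e = X 0 ^ a * X 3 ^ b * X 5 ^ c * X 1 := by
  have ha : (2 * a + 1) / 2 = a := by omega
  have hb : (2 * b + 1) / 2 = b := by omega
  simp [monomialLift, h₀, h₁, h₂, ha, hb]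

theorem even_degree_cases (h : Even (e 0 + e 1 + e 2)) : ∃ a b c,
    (e 0 = 2 * a ∧ e 1 = 2 * b ∧ e 2 = 2 * c) ∨
    (e 0 = 2 * a ∧ e 1 = 2 * b + 1 ∧ e 2 = 2 * c + 1) ∨
    (e 0 = 2 * a + 1 ∧ e 1 = 2 * b ∧ e 2 = 2 * c + 1) ∨
    (e 0 = 2 * a + 1 ∧ e 1 = 2 * b + 1 ∧ e 2 = 2 * c) := by
  refine ⟨e 0 / 2, e 1 / 2, e 2 / 2, ?_⟩
  rw [Nat.even_iff] at h
  omega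

theorem odd_degree_cases (h : Odd (e 0 + e 1 + e 2)) : ∃ a b c,
    (e 0 = 2 * a + 1 ∧ e 1 = 2 * b + 1 ∧ e 2 = 2 * c + 1) ∨
    (e 0 = 2 * a + 1 ∧ e 1 = 2 * b ∧ e 2 = 2 * c) ∨
    (e 0 = 2 * a ∧ e 1 = 2 * b + 1 ∧ e 2 = 2 * c) ∨
    (e 0 = 2 * a ∧ e 1 = 2 * b ∧ e 2 = 2 * c + 1) := by
  refine ⟨e 0 / 2, e 1 / 2, e 2 / 2, ?_⟩
  rw [Nat.odd_iff] at h
  omega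

end Parity

theorem theta_X (n : Fin 6) : theta k (X n) =
    (![X 0 * X 0, X 0 * X 1, X 0 * X 2, X 1 * X 1, X 1 * X 2, X 2 * X 2] : Fin 6 → R k) n := by
  simp [theta]

theorem theta_monomialLift {e : Fin 3 →₀ ℕ} (he : Even (e 0 + e 1 + e 2)) :
    theta k (monomialLift k e) = monomial e 1 := by
  have h : monomial e (1 : k) = X 0 ^ e 0 * X 1 ^ e 1 * X 2 ^ e 2 := by
    rw [monomial_eq, C_1, one_mul, Finsupp.prod_fintype _ _ (fun i => pow_zero _),
      Fin.prod_univ_three]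
  rw [h]
  obtain ⟨a, b, c, ⟨h0, h1, h2⟩ | ⟨h0, h1, h2⟩ | ⟨h0, h1, h2⟩ | ⟨h0, h1, h2⟩⟩ :=
    even_degree_cases he
  · rw [monomialLift_even h0 h1 h2, h0, h1, h2]
    simp only [map_mul, map_pow, theta_X]
    simp
    ring
  · rw [monomialLift_x₁₂ h0 h1 h2, h0, h1, h2]
    simp only [map_mul, map_pow, theta_X]
    simp
    ring
  · rw [monomialLift_x₀₂ h0 h1 h2, h0, h1, h2]
    simp only [map_mul, map_pow, theta_X]
    simp
    ring
  · rw [monomialLift_x₀₁ h0 h1 h2, h0, h1, h2]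
    simp only [map_mul, map_pow, theta_X]
    simp
    ring

theorem theta_C_mul_monomialLift (a : k) {e : Fin 3 →₀ ℕ} (he : Even (e 0 + e 1 + e 2)) :
    theta k (C a * monomialLift k e) = monomial e a := by
  rw [map_mul, theta_monomialLift he, ← algebraMap_eq, AlgHom.commutes, algebraMap_eq,
    C_mul_monomial, mul_one]

theorem theta_evenLift {g : R k} (hg : ∀ e ∈ g.support, Even (e 0 + e 1 + e 2)) :
    theta k (evenLift g) = g := by
  conv_rhs => rw [← support_sum_monomial_coeff g]
  rw [evenLift, map_sum]
  exact Finset.sum_congr rfl fun e he => theta_C_mul_monomialLift _ (hg e he)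

theorem sum_eq_of_isHomogeneous {g : R k} {d : ℕ} (hg : g.IsHomogeneous d) {e : Fin 3 →₀ ℕ}
    (he : e ∈ g.support) : e 0 + e 1 + e 2 = d := by
  rw [hg.degree_eq_sum_deg_support he, ← Fin.sum_univ_three e]
  exact (Finset.sum_subset (Finset.subset_univ _) fun i _ hi => Finsupp.notMem_support_iff.1 hi).symm

theorem theta_F {f : R k} {d : ℕ} (hf : f.IsHomogeneous d) (hd : Odd d) (n : Fin 3) :
    theta k (F f n) = X n * f :=
  theta_evenLift fun e he => by
    rw [sum_eq_of_isHomogeneous ((isHomogeneous_X k n).mul hf) he, add_comm]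
    exact hd.add_one

end Lift

/-! ### The kernel of θ is generated by the minors. -/

section Kernel

/-- The ideal of the Veronese surface. -/
noncomputable def minorIdeal (k : Type*) [Field k] : Ideal (S k) := Ideal.span (Set.range (delta k))

theorem mem_minorIdeal_of_eq {p : S k} (n : Fin 6) (r : S k) (h : p = r * delta k n) :
    p ∈ minorIdeal k :=
  h ▸ Ideal.mul_mem_left _ _ (Ideal.subset_span ⟨n, rfl⟩)

theorem theta_delta (n : Fin 6) : theta k (delta k n) = 0 := by
  fin_cases n <;> simp [delta, theta_X] <;> ring

theorem theta_eq_zero_of_mem {p : S k} (hp : p ∈ minorIdeal k) : theta k p = 0 := by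
  have : minorIdeal k ≤ RingHom.ker (theta k) := by
    rw [minorIdeal, Ideal.span_le]
    rintro _ ⟨n, rfl⟩
    exact theta_delta n
  exact this hp

/-- The exponent of the monomial `θ (X n)`. -/
noncomputable def thetaExponent : Fin 6 → (Fin 3 →₀ ℕ) :=
  ![Finsupp.single 0 1 + Finsupp.single 0 1, Finsupp.single 0 1 + Finsupp.single 1 1,
    Finsupp.single 0 1 + Finsupp.single 2 1, Finsupp.single 1 1 + Finsupp.single 1 1,
    Finsupp.single 1 1 + Finsupp.single 2 1, Finsupp.single 2 1 + Finsupp.single 2 1]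

theorem theta_X_eq_monomial (n : Fin 6) : theta k (X n) = monomial (thetaExponent n) 1 := by
  rw [theta_X]
  fin_cases n <;> simp [thetaExponent, X, monomial_mul]

/-- A normal form times a variable is again a normal form unless two off-diagonal variables meet.
Their product is then rewritten by a single minor, as x_ij² = x_ii x_jj or x_ij x_il = x_ii x_jl. In
the cases below, the witnesses `0 0` mark products that are already normal. -/
theorem monomialLift_mul_X_sub_mem {e : Fin 3 →₀ ℕ} (he : Even (e 0 + e 1 + e 2)) (n : Fin 6) :
    monomialLift k e * X n - monomialLift k (e + thetaExponent n) ∈ minorIdeal k := by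
  obtain ⟨E, hE⟩ : ∃ E, E = e + thetaExponent n := ⟨_, rfl⟩
  rw [← hE]
  have t0 : E 0 = e 0 + (![2, 1, 1, 0, 0, 0] : Fin 6 → ℕ) n := by
    subst hE; fin_cases n <;> simp [thetaExponent]
  have t1 : E 1 = e 1 + (![0, 1, 0, 2, 1, 0] : Fin 6 → ℕ) n := by
    subst hE; fin_cases n <;> simp [thetaExponent]
  have t2 : E 2 = e 2 + (![0, 0, 1, 0, 1, 2] : Fin 6 → ℕ) n := by
    subst hE; fin_cases n <;> simp [thetaExponent]
  clear hE
  obtain ⟨a, b, c, h⟩ := even_degree_cases he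
  fin_cases n <;> simp at t0 t1 t2 <;>
    obtain ⟨h0, h1, h2⟩ | ⟨h0, h1, h2⟩ | ⟨h0, h1, h2⟩ | ⟨h0, h1, h2⟩ := h
  · rw [monomialLift_even h0 h1 h2,
      monomialLift_even (a := a + 1) (b := b) (c := c) (by omega) (by omega) (by omega)]
    exact mem_minorIdeal_of_eq 0 0 (by simp [delta]; ring_nf)
  · rw [monomialLift_x₁₂ h0 h1 h2,
      monomialLift_x₁₂ (a := a + 1) (b := b) (c := c) (by omega) (by omega) (by omega)]
    exact mem_minorIdeal_of_eq 0 0 (by simp [delta]; ring_nf)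
  · rw [monomialLift_x₀₂ h0 h1 h2,
      monomialLift_x₀₂ (a := a + 1) (b := b) (c := c) (by omega) (by omega) (by omega)]
    exact mem_minorIdeal_of_eq 0 0 (by simp [delta]; ring_nf)
  · rw [monomialLift_x₀₁ h0 h1 h2,
      monomialLift_x₀₁ (a := a + 1) (b := b) (c := c) (by omega) (by omega) (by omega)]
    exact mem_minorIdeal_of_eq 0 0 (by simp [delta]; ring_nf)
  · rw [monomialLift_even h0 h1 h2,
      monomialLift_x₀₁ (a := a) (b := b) (c := c) (by omega) (by omega) (by omega)]
    exact mem_minorIdeal_of_eq 0 0 (by simp [delta])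
  · rw [monomialLift_x₁₂ h0 h1 h2,
      monomialLift_x₀₂ (a := a) (b := b + 1) (c := c) (by omega) (by omega) (by omega)]
    exact mem_minorIdeal_of_eq 2 (X 0 ^ a * X 3 ^ b * X 5 ^ c) (by simp [delta]; ring_nf)
  · rw [monomialLift_x₀₂ h0 h1 h2,
      monomialLift_x₁₂ (a := a + 1) (b := b) (c := c) (by omega) (by omega) (by omega)]
    exact mem_minorIdeal_of_eq 4 (-(X 0 ^ a * X 3 ^ b * X 5 ^ c)) (by simp [delta]; ring_nf)
  · rw [monomialLift_x₀₁ h0 h1 h2,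
      monomialLift_even (a := a + 1) (b := b + 1) (c := c) (by omega) (by omega) (by omega)]
    exact mem_minorIdeal_of_eq 5 (-(X 0 ^ a * X 3 ^ b * X 5 ^ c)) (by simp [delta]; ring_nf)
  · rw [monomialLift_even h0 h1 h2,
      monomialLift_x₀₂ (a := a) (b := b) (c := c) (by omega) (by omega) (by omega)]
    exact mem_minorIdeal_of_eq 0 0 (by simp [delta])
  · rw [monomialLift_x₁₂ h0 h1 h2,
      monomialLift_x₀₁ (a := a) (b := b) (c := c + 1) (by omega) (by omega) (by omega)]
    exact mem_minorIdeal_of_eq 1 (-(X 0 ^ a * X 3 ^ b * X 5 ^ c)) (by simp [delta]; ring_nf)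
  · rw [monomialLift_x₀₂ h0 h1 h2,
      monomialLift_even (a := a + 1) (b := b) (c := c + 1) (by omega) (by omega) (by omega)]
    exact mem_minorIdeal_of_eq 3 (-(X 0 ^ a * X 3 ^ b * X 5 ^ c)) (by simp [delta]; ring_nf)
  · rw [monomialLift_x₀₁ h0 h1 h2,
      monomialLift_x₁₂ (a := a + 1) (b := b) (c := c) (by omega) (by omega) (by omega)]
    exact mem_minorIdeal_of_eq 4 (-(X 0 ^ a * X 3 ^ b * X 5 ^ c)) (by simp [delta]; ring_nf)
  · rw [monomialLift_even h0 h1 h2,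
      monomialLift_even (a := a) (b := b + 1) (c := c) (by omega) (by omega) (by omega)]
    exact mem_minorIdeal_of_eq 0 0 (by simp [delta]; ring_nf)
  · rw [monomialLift_x₁₂ h0 h1 h2,
      monomialLift_x₁₂ (a := a) (b := b + 1) (c := c) (by omega) (by omega) (by omega)]
    exact mem_minorIdeal_of_eq 0 0 (by simp [delta]; ring_nf)
  · rw [monomialLift_x₀₂ h0 h1 h2,
      monomialLift_x₀₂ (a := a) (b := b + 1) (c := c) (by omega) (by omega) (by omega)]
    exact mem_minorIdeal_of_eq 0 0 (by simp [delta]; ring_nf)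
  · rw [monomialLift_x₀₁ h0 h1 h2,
      monomialLift_x₀₁ (a := a) (b := b + 1) (c := c) (by omega) (by omega) (by omega)]
    exact mem_minorIdeal_of_eq 0 0 (by simp [delta]; ring_nf)
  · rw [monomialLift_even h0 h1 h2,
      monomialLift_x₁₂ (a := a) (b := b) (c := c) (by omega) (by omega) (by omega)]
    exact mem_minorIdeal_of_eq 0 0 (by simp [delta])
  · rw [monomialLift_x₁₂ h0 h1 h2,
      monomialLift_even (a := a) (b := b + 1) (c := c + 1) (by omega) (by omega) (by omega)]
    exact mem_minorIdeal_of_eq 0 (-(X 0 ^ a * X 3 ^ b * X 5 ^ c)) (by simp [delta]; ring_nf)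
  · rw [monomialLift_x₀₂ h0 h1 h2,
      monomialLift_x₀₁ (a := a) (b := b) (c := c + 1) (by omega) (by omega) (by omega)]
    exact mem_minorIdeal_of_eq 1 (-(X 0 ^ a * X 3 ^ b * X 5 ^ c)) (by simp [delta]; ring_nf)
  · rw [monomialLift_x₀₁ h0 h1 h2,
      monomialLift_x₀₂ (a := a) (b := b + 1) (c := c) (by omega) (by omega) (by omega)]
    exact mem_minorIdeal_of_eq 2 (X 0 ^ a * X 3 ^ b * X 5 ^ c) (by simp [delta]; ring_nf)
  · rw [monomialLift_even h0 h1 h2,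
      monomialLift_even (a := a) (b := b) (c := c + 1) (by omega) (by omega) (by omega)]
    exact mem_minorIdeal_of_eq 0 0 (by simp [delta]; ring_nf)
  · rw [monomialLift_x₁₂ h0 h1 h2,
      monomialLift_x₁₂ (a := a) (b := b) (c := c + 1) (by omega) (by omega) (by omega)]
    exact mem_minorIdeal_of_eq 0 0 (by simp [delta]; ring_nf)
  · rw [monomialLift_x₀₂ h0 h1 h2,
      monomialLift_x₀₂ (a := a) (b := b) (c := c + 1) (by omega) (by omega) (by omega)]
    exact mem_minorIdeal_of_eq 0 0 (by simp [delta]; ring_nf)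
  · rw [monomialLift_x₀₁ h0 h1 h2,
      monomialLift_x₀₁ (a := a) (b := b) (c := c + 1) (by omega) (by omega) (by omega)]
    exact mem_minorIdeal_of_eq 0 0 (by simp [delta]; ring_nf)

/-- Reduction to normal form modulo the minors: monomials are built up one variable at a time, and
the normal form depends only on the image under θ. -/
theorem sub_evenLift_theta_mem (p : S k) : p - evenLift (theta k p) ∈ minorIdeal k := by
  have key : ∀ (u : Fin 6 →₀ ℕ) (a : k), ∃ (e : Fin 3 →₀ ℕ) (b : k),
      Even (e 0 + e 1 + e 2) ∧ theta k (monomial u a) = monomial e b ∧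
      monomial u a - C b * monomialLift k e ∈ minorIdeal k := by
    refine induction_on_monomial (motive := fun p : S k => ∃ (e : Fin 3 →₀ ℕ) (b : k),
      Even (e 0 + e 1 + e 2) ∧ theta k p = monomial e b ∧
      p - C b * monomialLift k e ∈ minorIdeal k) (fun a => ?_) (fun p n => ?_)
    · refine ⟨0, a, by simp, by simp [theta], ?_⟩
      rw [monomialLift_even (a := 0) (b := 0) (c := 0) rfl rfl rfl]
      simp
    · rintro ⟨e, b, he, hp, hm⟩
      refine ⟨e + thetaExponent n, b, ?_, ?_, ?_⟩
      · have : Even (thetaExponent n 0 + thetaExponent n 1 + thetaExponent n 2) := by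
          fin_cases n <;> simp [thetaExponent]
        have := he.add this
        rw [Nat.even_iff] at this ⊢
        simp only [Finsupp.add_apply]
        omega
      · rw [map_mul, hp, theta_X_eq_monomial, monomial_mul, mul_one]
      · rw [show p * X n - C b * monomialLift k (e + thetaExponent n) =
          (p - C b * monomialLift k e) * X n +
            C b * (monomialLift k e * X n - monomialLift k (e + thetaExponent n)) by ring]
        exact add_mem (Ideal.mul_mem_right _ _ hm)
          (Ideal.mul_mem_left _ _ (monomialLift_mul_X_sub_mem he n))
  induction p using MvPolynomial.induction_on' with
  | monomial u a =>
    obtain ⟨e, b, -, h1, h2⟩ := key u a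
    rwa [h1, evenLift_monomial]
  | add p q hp hq =>
    rw [map_add, evenLift_add, add_sub_add_comm]
    exact add_mem hp hq

theorem theta_eq_zero_iff {p : S k} : theta k p = 0 ↔ p ∈ minorIdeal k := by
  refine ⟨fun h => ?_, theta_eq_zero_of_mem⟩
  have := sub_evenLift_theta_mem p
  rwa [h, show evenLift (0 : R k) = 0 from map_zero (evenLiftHom k), sub_zero] at this

end Kernel

/-! ### The forms Fₙ in terms of the parity parts of f. -/

section ParityParts

theorem parityPart_eq_sum (ε : Fin 3 → ℕ) (f : R k) :
    parityPart ε f = ∑ e ∈ f.support, C (f.coeff e) *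
      (if e 0 % 2 = ε 0 ∧ e 1 % 2 = ε 1 ∧ e 2 % 2 = ε 2 then
        X 0 ^ (e 0 / 2) * X 3 ^ (e 1 / 2) * X 5 ^ (e 2 / 2) else 0) := by
  rw [parityPart, Finset.sum_filter]
  refine Finset.sum_congr rfl fun e _ => ?_
  simp only [Fin.forall_fin_succ, mul_ite, mul_zero]
  simp

variable {f : R k}

/-- Multiplying a monomial by xₙ flips the parity of one exponent. If that exponent was odd, halving
carries and yields x_nn; the exponents that are odd afterwards select the off-diagonal factor. -/
theorem F_eq (hf : ∀ e ∈ f.support, Odd (e 0 + e 1 + e 2)) (n : Fin 3) :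
    F f n = (![X 0 * X 4, X 3 * X 2, X 5 * X 1] : Fin 3 → S k) n * hI f +
      (![X 0, X 1, X 2] : Fin 3 → S k) n * hII f + (![X 1, X 3, X 4] : Fin 3 → S k) n * hIII f +
      (![X 2, X 4, X 5] : Fin 3 → S k) n * hIV f := by
  rw [F, evenLift_X_mul, hI, hII, hIII, hIV]
  simp only [parityPart_eq_sum, Finset.mul_sum, ← Finset.sum_add_distrib]
  refine Finset.sum_congr rfl fun e he => ?_
  have hdiv : ∀ a, (2 * a + 1) / 2 = a := fun a => by omega
  obtain ⟨a, b, c, ⟨h0, h1, h2⟩ | ⟨h0, h1, h2⟩ | ⟨h0, h1, h2⟩ | ⟨h0, h1, h2⟩⟩ :=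
    odd_degree_cases (hf e he) <;> fin_cases n
  · rw [monomialLift_x₁₂ (a := a + 1) (b := b) (c := c) (by simp [h0]; omega) (by simp [h1])
      (by simp [h2])]
    simp [h0, h1, h2, hdiv]
    ring_nf
  · rw [monomialLift_x₀₂ (a := a) (b := b + 1) (c := c) (by simp [h0]) (by simp [h1]; omega)
      (by simp [h2])]
    simp [h0, h1, h2, hdiv]
    ring_nf
  · rw [monomialLift_x₀₁ (a := a) (b := b) (c := c + 1) (by simp [h0]) (by simp [h1])
      (by simp [h2]; omega)]
    simp [h0, h1, h2, hdiv]
    ring_nf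
  · rw [monomialLift_even (a := a + 1) (b := b) (c := c) (by simp [h0]; omega) (by simp [h1])
      (by simp [h2])]
    simp [h0, h1, h2, hdiv]
    ring_nf
  · rw [monomialLift_x₀₁ (a := a) (b := b) (c := c) (by simp [h0]) (by simp [h1]; omega)
      (by simp [h2])]
    simp [h0, h1, h2, hdiv]
    ring_nf
  · rw [monomialLift_x₀₂ (a := a) (b := b) (c := c) (by simp [h0]) (by simp [h1])
      (by simp [h2]; omega)]
    simp [h0, h1, h2, hdiv]
    ring_nf
  · rw [monomialLift_x₀₁ (a := a) (b := b) (c := c) (by simp [h0]; omega) (by simp [h1])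
      (by simp [h2])]
    simp [h0, h1, h2, hdiv]
    ring_nf
  · rw [monomialLift_even (a := a) (b := b + 1) (c := c) (by simp [h0]) (by simp [h1]; omega)
      (by simp [h2])]
    simp [h0, h1, h2, hdiv]
    ring_nf
  · rw [monomialLift_x₁₂ (a := a) (b := b) (c := c) (by simp [h0]) (by simp [h1])
      (by simp [h2]; omega)]
    simp [h0, h1, h2, hdiv]
    ring_nf
  · rw [monomialLift_x₀₂ (a := a) (b := b) (c := c) (by simp [h0]; omega) (by simp [h1])
      (by simp [h2])]
    simp [h0, h1, h2, hdiv]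
    ring_nf
  · rw [monomialLift_x₁₂ (a := a) (b := b) (c := c) (by simp [h0]) (by simp [h1]; omega)
      (by simp [h2])]
    simp [h0, h1, h2, hdiv]
    ring_nf
  · rw [monomialLift_even (a := a) (b := b) (c := c + 1) (by simp [h0]) (by simp [h1])
      (by simp [h2]; omega)]
    simp [h0, h1, h2, hdiv]
    ring_nf

theorem isHomogeneous_parityPart (ε : Fin 3 → ℕ) {d r : ℕ} (hf : f.IsHomogeneous d)
    (hd : d = 2 * r + (ε 0 + ε 1 + ε 2)) : (parityPart ε f).IsHomogeneous r := by
  refine IsHomogeneous.sum _ _ _ fun e he => ?_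
  rw [Finset.mem_filter] at he
  have h := sum_eq_of_isHomogeneous hf he.1
  have h0 := he.2 0
  have h1 := he.2 1
  have h2 := he.2 2
  have hr : r = 0 + (e 0 / 2 + e 1 / 2 + e 2 / 2) := by omega
  rw [hr]
  exact (isHomogeneous_C _ _).mul
    (((isHomogeneous_X_pow _ _).mul (isHomogeneous_X_pow _ _)).mul (isHomogeneous_X_pow _ _))

theorem delta_mul_Vtop_add_F_mul_Y (hf : ∀ e ∈ f.support, Odd (e 0 + e 1 + e 2)) :
    Matrix.replicateRow (Fin 1) (delta k) * Vtop f + Matrix.replicateRow (Fin 1) (F f) * Y k =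
      0 := by
  ext1 i j
  rw [Matrix.add_apply, Matrix.mul_apply, Matrix.mul_apply, Matrix.zero_apply]
  simp only [Matrix.replicateRow_apply, F_eq hf]
  fin_cases j <;> simp [Vtop, Y, delta, Fin.sum_univ_succ] <;> ring_nf

end ParityParts

/-! ### Generators of the odd part and their relations. -/

section Kernel

/-- Modulo x₀₀, x₀₁, x₀₂ the ring is still a domain, and the minor x₁₁x₂₂ - x₁₂² stays nonzero
there. -/
theorem exists_eq_of_mul_minor_eq {u p q r : S k}
    (h : u * (X 3 * X 5 - X 4 ^ 2) = X 0 * p + X 1 * q + X 2 * r) :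
    ∃ p q r : S k, u = X 0 * p + X 1 * q + X 2 * r := by
  obtain ⟨a, ha⟩ := X_dvd_sub_kill 2 u
  obtain ⟨b, hb⟩ := X_dvd_sub_kill 1 (kill k 2 u)
  obtain ⟨c, hc⟩ := X_dvd_sub_kill 0 (kill k 1 (kill k 2 u))
  have h0 : kill k 0 (kill k 1 (kill k 2 u)) = 0 := by
    have h' := congrArg (fun x => kill k 0 (kill k 1 (kill k 2 x))) h
    simp [kill_X_of_ne] at h'
    refine h'.resolve_right fun hd => ?_
    have := congrArg (kill k 3) hd
    simp [kill_X_of_ne] at this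
  exact ⟨c, b, a, by linear_combination ha + hb + hc + h0⟩

/-- Multiplying the relation by x₀ makes it the θ-image of x₀₀w₀ + x₀₁w₁ + x₀₂w₂, which is therefore
a combination of minors. Every minor except Δ₀₀ lies in (x₀₀, x₀₁, x₀₂), so once Δ₀₀ is eliminated
only Koszul relations on these three variables remain. -/
theorem exists_eq_Y_mulVec (w : Fin 3 → S k) (h : ∑ i, X i * theta k (w i) = 0) :
    ∃ z, w = (Y k).mulVec z := by
  have hmem : X 0 * w 0 + X 1 * w 1 + X 2 * w 2 ∈ minorIdeal k := by
    rw [← theta_eq_zero_iff]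
    simp only [map_add, map_mul, theta_X]
    rw [Fin.sum_univ_three] at h
    simp
    linear_combination X 0 * h
  obtain ⟨u, hu⟩ := Ideal.mem_span_range_iff_exists_fun.1 hmem
  simp [Fin.sum_univ_succ, delta] at hu
  obtain ⟨p, q, r, h0⟩ := exists_eq_of_mul_minor_eq (u := u 0)
    (p := w 0 - u 3 * X 5 - u 4 * X 4 - u 5 * X 3)
    (q := w 1 - u 1 * X 5 - u 2 * X 4 + u 5 * X 1)
    (r := w 2 + u 1 * X 4 + u 2 * X 3 + u 3 * X 2 + u 4 * X 1) (by linear_combination hu)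
  -- Columns 5, 2 and 0 of `M₂` express x₀₀Δ₀₀, x₀₁Δ₀₀ and x₀₂Δ₀₀ by the other minors; the new
  -- coefficients absorb them.
  obtain ⟨u₁, h1⟩ : ∃ y, y = u 1 + q * X 3 + r * X 4 := ⟨_, rfl⟩
  obtain ⟨u₂, h2⟩ : ∃ y, y = u 2 - p * X 2 - q * X 4 - r * X 5 := ⟨_, rfl⟩
  obtain ⟨u₃, h3⟩ : ∃ y, y = u 3 + p * X 3 := ⟨_, rfl⟩
  obtain ⟨u₄, h4⟩ : ∃ y, y = u 4 - p * X 4 := ⟨_, rfl⟩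
  have hu' : X 2 * (w 2 + u₁ * X 4 + u₂ * X 3 + u₃ * X 2 + u₄ * X 1) =
      X 0 * (-(w 0 - u₃ * X 5 - u₄ * X 4 - u 5 * X 3)) +
        X 1 * (-(w 1 - u₁ * X 5 - u₂ * X 4 + u 5 * X 1)) := by
    rw [h1, h2, h3, h4]
    linear_combination -hu + (X 3 * X 5 - X 4 ^ 2) * h0
  obtain ⟨r', s', e2⟩ := eq_X_mul_add_of_X_mul_eq (by decide) (by decide) (by decide) hu'
  obtain ⟨t, e1, e0⟩ := isRegularPair_X (k := k) (i := (0 : Fin 6)) (j := 1) (by decide)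
    (w 1 - u₁ * X 5 - u₂ * X 4 + u 5 * X 1 + X 2 * s')
    (-(w 0 - u₃ * X 5 - u₄ * X 4 - u 5 * X 3 + X 2 * r')) (by linear_combination hu' - X 2 * e2)
  -- The parameters t, r', s' multiply the three Koszul columns of `Y`; the other columns come from
  -- the five remaining minors.
  refine ⟨![-t, u 5, -r', u₄, u₃, -s', u₂, u₁], ?_⟩
  funext i
  fin_cases i <;> simp [Y, Matrix.mulVec, dotProduct, Fin.sum_univ_succ]
  · linear_combination -e0
  · linear_combination e1
  · linear_combination e2

/-- Polynomials with only terms of odd degree are generated by the variables over the image of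
`θ`. -/
theorem exists_eq_sum_X_mul_theta {q : R k} (hq : ∀ e ∈ q.support, Odd (e 0 + e 1 + e 2)) :
    ∃ w : Fin 3 → S k, q = ∑ i, X i * theta k (w i) := by
  rw [← support_sum_monomial_coeff q]
  refine Finset.sum_induction _ (fun q => ∃ w : Fin 3 → S k, q = ∑ i, X i * theta k (w i))
    ?_ ?_ fun e he => ?_
  · rintro _ _ ⟨v, rfl⟩ ⟨w, rfl⟩
    exact ⟨v + w, by simp [mul_add, Finset.sum_add_distrib]⟩
  · exact ⟨0, by simp⟩
  · have hodd := hq e he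
    obtain ⟨i, hi⟩ : ∃ i, 1 ≤ e i := by
      by_contra! h
      simp [Nat.lt_one_iff.1 (h 0), Nat.lt_one_iff.1 (h 1), Nat.lt_one_iff.1 (h 2)] at hodd
    have hsplit : Finsupp.single i 1 + (e - Finsupp.single i 1) = e :=
      add_tsub_cancel_of_le (Finsupp.single_le_iff.2 hi)
    obtain ⟨e', he'⟩ : ∃ e', e' = e - Finsupp.single i 1 := ⟨_, rfl⟩
    rw [← he'] at hsplit
    have heven : Even (e' 0 + e' 1 + e' 2) := by
      rw [← hsplit] at hodd
      rw [Nat.odd_iff] at hodd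
      rw [Nat.even_iff]
      fin_cases i <;> simp at hodd <;> omega
    refine ⟨Pi.single i (C (q.coeff e) * monomialLift k e'), ?_⟩
    rw [Finset.sum_eq_single i]
    · rw [Pi.single_eq_same, theta_C_mul_monomialLift _ heven, X, monomial_mul, hsplit, one_mul]
    · intro j _ hj
      simp [hj]
    · simp

end Kernel

/-! ### Points of the curve and the ideal of its image. -/

section Points

variable {K : Type*} [Field K] [Algebra k K]

theorem aeval_veroneseVec (a : Fin 3 → K) (G : S k) :
    aeval (veroneseVec a) G = aeval a (theta k G) := by
  have : aeval (veroneseVec a) = (aeval a).comp (theta k) := by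
    ext n
    rw [AlgHom.comp_apply, theta_X, aeval_X]
    fin_cases n <;> simp [veroneseVec, pow_two]
  rw [this, AlgHom.comp_apply]

theorem aeval_smul_of_isHomogeneous {N d : ℕ} {f : MvPolynomial (Fin N) k}
    (hf : f.IsHomogeneous d) (c : K) (a : Fin N → K) :
    aeval (c • a) f = c ^ d * aeval a f := by
  rw [aeval_def, eval₂_eq', aeval_def, eval₂_eq', Finset.mul_sum]
  refine Finset.sum_congr rfl fun e he => ?_
  have h : d = ∑ i, e i := by
    rw [hf.degree_eq_sum_deg_support he]
    exact Finset.sum_subset (Finset.subset_univ _) fun i _ hi => Finsupp.notMem_support_iff.1 hi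
  rw [h, ← Finset.prod_pow_eq_pow_sum]
  simp only [Pi.smul_apply, smul_eq_mul, mul_pow, Finset.prod_mul_distrib]
  ring

theorem mk_mem_zeros_iff {N d : ℕ} {f : MvPolynomial (Fin N) k} (hf : f.IsHomogeneous d)
    {a : Fin N → K} (ha : a ≠ 0) :
    Projectivization.mk K a ha ∈ zeros K f ↔ aeval a f = 0 := by
  refine ⟨fun h => h a ha rfl, fun h v hv hva => ?_⟩
  obtain ⟨c, hc⟩ := (Projectivization.mk_eq_mk_iff' K _ _ _ _).1 hva
  rw [← hc, aeval_smul_of_isHomogeneous hf, h, mul_zero]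

theorem veronese_mk {a : Fin 3 → K} (ha : a ≠ 0) :
    veronese (Projectivization.mk K a ha) =
      Projectivization.mk K (veroneseVec a) (veroneseVec_ne_zero ha) := rfl

/-- Vanishing is required at every representative. Scaling a by t scales its image by t², so square
roots in K are needed to reach all representatives of the image point. -/
theorem vanishesAt_veronese_iff [IsAlgClosed K] {a : Fin 3 → K} (ha : a ≠ 0) (G : S k) :
    VanishesAt G (veronese (Projectivization.mk K a ha)) ↔
      VanishesAt (theta k G) (Projectivization.mk K a ha) := by
  rw [veronese_mk]
  constructor
  · intro h v hv hva
    rw [← aeval_veroneseVec]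
    exact h _ (veroneseVec_ne_zero hv) (by rw [← veronese_mk hv, ← veronese_mk ha, hva])
  · intro h v hv hva
    obtain ⟨c, hc⟩ := (Projectivization.mk_eq_mk_iff' K _ _ _ _).1 hva
    obtain ⟨t, ht⟩ := IsAlgClosed.exists_pow_nat_eq c (n := 2) (by norm_num)
    have hv' : v = veroneseVec (t • a) := by rw [veroneseVec_smul, ht, hc]
    have ht0 : t ≠ 0 := by
      rintro rfl
      exact hv (by rw [← hc, ← ht]; simp)
    rw [hv', aeval_veroneseVec]
    exact h _ (smul_ne_zero ht0 ha) ((Projectivization.mk_eq_mk_iff' K _ _ _ _).2 ⟨t, rfl⟩)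

/-- Nullstellensatz for the prime ideal (f). Projective vanishing says nothing at the origin, so it
is applied to X j * g; the prime f cannot divide X j because its degree exceeds 1. -/
theorem dvd_of_vanishes [IsAlgClosed K] {N d : ℕ} {f g : MvPolynomial (Fin N) k} (j : Fin N)
    (hd : 1 < d) (hf : f.IsHomogeneous d) (hirr : Irreducible f)
    (hg : ∀ p ∈ zeros K f, VanishesAt g p) : f ∣ g := by
  have hp : Prime f := hirr.prime
  have : (Ideal.span {f}).IsPrime := (Ideal.span_singleton_prime hp.ne_zero).2 hp
  have hmem : X j * g ∈ vanishingIdeal k (zeroLocus K (Ideal.span {f})) := by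
    rw [mem_vanishingIdeal_iff]
    intro a ha
    rw [mem_zeroLocus_iff] at ha
    have hfa : aeval a f = 0 := ha f (Ideal.mem_span_singleton_self f)
    by_cases h0 : a = 0
    · simp [h0]
    · rw [map_mul, hg _ ((mk_mem_zeros_iff hf h0).2 hfa) a h0 rfl, mul_zero]
  rw [IsPrime.vanishingIdeal_zeroLocus, Ideal.mem_span_singleton] at hmem
  refine (hp.dvd_or_dvd hmem).resolve_left ?_
  rintro ⟨h, hh⟩
  have hh0 : h ≠ 0 := by rintro rfl; simp at hh
  have := congrArg totalDegree hh
  rw [totalDegree_X, totalDegree_mul_of_isDomain hp.ne_zero hh0, hf.totalDegree hp.ne_zero] at this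
  omega

theorem isHomogeneous_theta {G : S k} {n : ℕ} (hG : G.IsHomogeneous n) :
    (theta k G).IsHomogeneous (2 * n) := by
  refine hG.aeval _ (n := 2) fun i => ?_
  fin_cases i <;> exact isHomogeneous_X_mul_X _ _

theorem homogeneousIdeal_eq [IsAlgClosed K] {m : ℕ} (hm : 2 ≤ m) {f : R k}
    (hf : f.IsHomogeneous (2 * m - 1)) (hirr : Irreducible f)
    (hF : ∀ n, (F f n).IsHomogeneous m) :
    homogeneousIdeal k (veronese '' zeros K f) =
      Ideal.span (Set.range (delta k) ∪ Set.range (F f)) := by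
  have hodd : Odd (2 * m - 1) := ⟨m - 1, by omega⟩
  apply le_antisymm
  · refine Ideal.span_le.2 ?_
    rintro G ⟨⟨n, hG⟩, hGZ⟩
    obtain ⟨q, hq⟩ : f ∣ theta k G := by
      refine dvd_of_vanishes (K := K) 0 (by omega) hf hirr fun p hp => ?_
      induction p using Projectivization.ind with
      | h a ha => exact (vanishesAt_veronese_iff ha G).1 (hGZ _ ⟨_, hp, rfl⟩)
    -- Divisibility gives no control on the degree of q. Its component of degree 2n - (2m - 1)
    -- serves as well: it is odd, or the component is zero when 2n < 2m - 1.
    have hq' : theta k G = f * shiftedComponent (2 * m - 1) (2 * n) q := by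
      rw [← homogeneousComponent_mul_of_isHomogeneous hf, ← hq,
        homogeneousComponent_eq_self (isHomogeneous_theta hG)]
    obtain ⟨w, hw⟩ := exists_eq_sum_X_mul_theta
      (q := shiftedComponent (2 * m - 1) (2 * n) q) (fun e he => by
        unfold shiftedComponent at he
        split_ifs at he with h
        · rw [sum_eq_of_isHomogeneous (homogeneousComponent_isHomogeneous _ _) he]
          exact ⟨n - m, by omega⟩
        · simp at he)
    have hker : G - ∑ i, F f i * w i ∈ minorIdeal k := by
      rw [← theta_eq_zero_iff, map_sub, hq', hw, map_sum, Finset.mul_sum, sub_eq_zero]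
      refine Finset.sum_congr rfl fun i _ => ?_
      rw [map_mul, theta_F hf hodd]
      ring
    rw [SetLike.mem_coe, ← sub_add_cancel G (∑ i, F f i * w i)]
    refine add_mem (Ideal.span_mono Set.subset_union_left hker) (sum_mem fun i _ => ?_)
    exact Ideal.mul_mem_right _ _ (Ideal.subset_span (Or.inr ⟨i, rfl⟩))
  · refine Ideal.span_mono ?_
    rintro _ (⟨n, rfl⟩ | ⟨n, rfl⟩)
    · refine ⟨⟨2, isHomogeneous_delta n⟩, ?_⟩
      rintro _ ⟨p, -, rfl⟩
      induction p using Projectivization.ind with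
      | h a ha =>
        rw [vanishesAt_veronese_iff, theta_delta]
        exact fun v _ _ => map_zero _
    · refine ⟨⟨m, hF n⟩, ?_⟩
      rintro _ ⟨p, hp, rfl⟩
      induction p using Projectivization.ind with
      | h a ha =>
        rw [vanishesAt_veronese_iff, theta_F hf hodd]
        intro v hv hva
        rw [map_mul, hp v hv hva, mul_zero]

end Points

/-! ### Degrees of matrix entries, graded maps and minimality. -/

section Graded

theorem mem_component_of_isHomogeneous {p : S k} {d : ℕ} (hp : p.IsHomogeneous d) :
    p ∈ component k (d : ℤ) := by
  rw [component, if_pos (Int.natCast_nonneg d), Int.toNat_natCast]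
  exact hp

theorem mul_mem_component {p q : S k} {d : ℕ} {e : ℤ} (hp : p.IsHomogeneous d)
    (hq : q ∈ component k e) : p * q ∈ component k (d + e) := by
  unfold component at hq
  split_ifs at hq with h
  · lift e to ℕ using h
    rw [Int.toNat_natCast] at hq
    exact_mod_cast mem_component_of_isHomogeneous (hp.mul hq)
  · rw [(Submodule.mem_bot k).1 hq, mul_zero]
    exact zero_mem _

/-- The matrix `M` has degree `0` as a map of graded modules and no unit entries. -/
def HasPositiveDegrees {ι κ : Type*} (a : ι → ℤ) (b : κ → ℤ) (M : Matrix ι κ (S k)) : Prop :=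
  ∀ i j, M i j = 0 ∨ ∃ d : ℕ, 0 < d ∧ (d : ℤ) = a i - b j ∧ (M i j).IsHomogeneous d

theorem HasPositiveDegrees.isGradedMap {ι κ : Type*} [Fintype κ] {a : ι → ℤ} {b : κ → ℤ}
    {M : Matrix ι κ (S k)} (h : HasPositiveDegrees a b M) : IsGradedMap a b M := by
  intro n v hv i _
  change ∑ j, M i j * v j ∈ component k (a i + n)
  refine sum_mem fun j _ => ?_
  rcases h i j with h0 | ⟨d, -, hd, hM⟩
  · rw [h0, zero_mul]
    exact zero_mem _
  · have := mul_mem_component hM (hv j (Set.mem_univ j))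
    rwa [hd, show a i - b j + (b j + n) = a i + n by ring] at this

theorem HasPositiveDegrees.isMinimalMatrix {ι κ : Type*} {a : ι → ℤ} {b : κ → ℤ}
    {M : Matrix ι κ (S k)} (h : HasPositiveDegrees a b M) : IsMinimalMatrix M := by
  intro i j
  rcases h i j with h0 | ⟨d, hpos, -, hM⟩
  · rw [h0, map_zero]
  · rw [constantCoeff_eq]
    exact hM.coeff_eq_zero (by simpa using hpos.ne)

end Graded

/-! ### Degrees of the entries that depend on f, with m = n + 2 to avoid truncated subtraction. -/

section Degrees

variable {f : R k} {n : ℕ}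

theorem isHomogeneous_F (hf : f.IsHomogeneous (2 * n + 3)) (i : Fin 3) :
    (F f i).IsHomogeneous (n + 2) := by
  have h1 : (hI f).IsHomogeneous n := isHomogeneous_parityPart _ hf rfl
  have h2 : (hII f).IsHomogeneous (n + 1) := isHomogeneous_parityPart _ hf rfl
  have h3 : (hIII f).IsHomogeneous (n + 1) := isHomogeneous_parityPart _ hf rfl
  have h4 : (hIV f).IsHomogeneous (n + 1) := isHomogeneous_parityPart _ hf rfl
  have hXX : ∀ (i j : Fin 6) {p : S k}, p.IsHomogeneous n → (X i * X j * p).IsHomogeneous (n + 2) :=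
    fun i j p hp => add_comm 2 n ▸ (isHomogeneous_X_mul_X i j).mul hp
  have hX : ∀ (i : Fin 6) {p : S k}, p.IsHomogeneous (n + 1) → (X i * p).IsHomogeneous (n + 2) :=
    fun i p hp => add_comm 1 (n + 1) ▸ (isHomogeneous_X k i).mul hp
  rw [F_eq fun e he => by
    rw [sum_eq_of_isHomogeneous hf he]
    exact ⟨n + 1, by ring⟩]
  refine ((IsHomogeneous.add ?_ ?_).add ?_).add ?_
  · fin_cases i <;> exact hXX _ _ h1
  · fin_cases i <;> exact hX _ h2
  · fin_cases i <;> exact hX _ h3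
  · fin_cases i <;> exact hX _ h4

theorem isHomogeneous_Vtop (hf : f.IsHomogeneous (2 * n + 3)) (i : Fin 6) (j : Fin 8) :
    (Vtop f i j).IsHomogeneous (n + 1) := by
  have h1 : (hI f).IsHomogeneous n := isHomogeneous_parityPart _ hf rfl
  have h2 : (hII f).IsHomogeneous (n + 1) := isHomogeneous_parityPart _ hf rfl
  have h3 : (hIII f).IsHomogeneous (n + 1) := isHomogeneous_parityPart _ hf rfl
  have h4 : (hIV f).IsHomogeneous (n + 1) := isHomogeneous_parityPart _ hf rfl
  have hX : ∀ i : Fin 6, (X i * hI f).IsHomogeneous (n + 1) :=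
    fun i => add_comm 1 n ▸ (isHomogeneous_X k i).mul h1
  fin_cases i <;> fin_cases j <;> simp [Vtop, isHomogeneous_zero, IsHomogeneous.neg, *]

theorem isHomogeneous_Ktop (hf : f.IsHomogeneous (2 * n + 3)) (i : Fin 8) (j : Fin 6) :
    (Ktop f i j).IsHomogeneous (n + 1) := by
  have h1 : (hI f).IsHomogeneous n := isHomogeneous_parityPart _ hf rfl
  have h2 : (hII f).IsHomogeneous (n + 1) := isHomogeneous_parityPart _ hf rfl
  have h3 : (hIII f).IsHomogeneous (n + 1) := isHomogeneous_parityPart _ hf rfl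
  have h4 : (hIV f).IsHomogeneous (n + 1) := isHomogeneous_parityPart _ hf rfl
  have hX : ∀ i : Fin 6, (X i * hI f).IsHomogeneous (n + 1) :=
    fun i => add_comm 1 n ▸ (isHomogeneous_X k i).mul h1
  fin_cases i <;> fin_cases j <;> simp [Ktop, isHomogeneous_zero, IsHomogeneous.neg, *]

/-- Reduces the degrees of the upper entries of `β₄` to those of the Fᵢ. -/
theorem Jtop_eq (hf : ∀ e ∈ f.support, Odd (e 0 + e 1 + e 2)) (i : Fin 3) (j : Fin 1) :
    Jtop f i j = (![-1, 1, -1] : Fin 3 → S k) i * F f i := by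
  rw [F_eq hf]
  fin_cases i <;> fin_cases j <;> simp [Jtop] <;> ring_nf

theorem isHomogeneous_Jtop (hf : f.IsHomogeneous (2 * n + 3)) (i : Fin 3) (j : Fin 1) :
    (Jtop f i j).IsHomogeneous (n + 2) := by
  have h := isHomogeneous_F hf
  rw [Jtop_eq fun e he => by
    rw [sum_eq_of_isHomogeneous hf he]
    exact ⟨n + 1, by ring⟩]
  fin_cases i <;> simp [IsHomogeneous.neg, h]

end Degrees

/-! ### Exactness of the mapping cone. -/

section MappingCone

variable {f : R k}

theorem β₁_eq (f : R k) : β₁ f =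
    Matrix.fromCols (Matrix.replicateRow (Fin 1) (delta k)) (Matrix.replicateRow (Fin 1) (F f)) := by
  ext1 i j
  rcases j with j | j <;> rfl

theorem β₁_mul_β₂ (hf : ∀ e ∈ f.support, Odd (e 0 + e 1 + e 2)) : β₁ f * β₂ f = 0 := by
  rw [β₁_eq, β₂, Matrix.fromCols_mul_fromBlocks, delta_mul_M₂, delta_mul_Vtop_add_F_mul_Y hf,
    Matrix.mul_zero, add_zero, Matrix.fromCols_zero]

theorem β₂_mul_β₃ (f : R k) : β₂ f * β₃ f = 0 := by
  rw [β₂, β₃, Matrix.fromBlocks_multiply, M₂_mul_M₃, M₂_mul_Ktop_add_Vtop_mul_L, Y_mul_L]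
  simp

theorem β₃_mul_β₄ (f : R k) : β₃ f * β₄ f = 0 := by
  rw [β₃, β₄, Matrix.fromBlocks_mul_fromRows, M₃_mul_Jtop_add_Ktop_mul_J', L_mul_J']
  simp

theorem exact_of_exists {ι κ μ : Type*} [Fintype κ] [Fintype μ] {N : Matrix ι κ (S k)}
    {M : Matrix κ μ (S k)} (hNM : N * M = 0) (h : ∀ v, N.mulVec v = 0 → ∃ w, v = M.mulVec w) :
    Function.Exact M.mulVecLin N.mulVecLin := by
  intro v
  constructor
  · intro hv
    obtain ⟨w, hw⟩ := h v hv
    exact ⟨w, hw.symm⟩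
  · rintro ⟨w, rfl⟩
    rw [Matrix.mulVecLin_apply, Matrix.mulVecLin_apply, Matrix.mulVec_mulVec, hNM,
      Matrix.zero_mulVec]

/-- This is where injectivity of multiplication by f enters: θ kills the minors and turns the
relation into f · Σ xᵢ θ(vᵢ) = 0. -/
theorem exact_β₂_β₁ {d : ℕ} (hf : f.IsHomogeneous d) (hd : Odd d) (hf0 : f ≠ 0) :
    Function.Exact (β₂ f).mulVecLin (β₁ f).mulVecLin := by
  have hsupp : ∀ e ∈ f.support, Odd (e 0 + e 1 + e 2) := fun e he => by
    rwa [sum_eq_of_isHomogeneous hf he]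
  refine exact_of_exists (β₁_mul_β₂ hsupp) fun v hv => ?_
  rw [β₁_eq, Matrix.fromCols_mulVec] at hv
  have h0 : ∑ i, X i * theta k (v (Sum.inr i)) = 0 := by
    have h := congrArg (theta k) (congrFun hv 0)
    simp only [Pi.add_apply, Matrix.mulVec, dotProduct, Matrix.replicateRow_apply, map_add,
      map_sum, map_mul, theta_delta, theta_F hf hd, zero_mul, Finset.sum_const_zero, zero_add,
      Pi.zero_apply, map_zero, Function.comp_apply] at h
    refine (mul_eq_zero.1 (?_ : f * _ = 0)).resolve_left hf0
    rw [← h, Finset.mul_sum]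
    exact Finset.sum_congr rfl fun i _ => by ring
  obtain ⟨z, hz⟩ := exists_eq_Y_mulVec (v ∘ Sum.inr) h0
  -- After the lower part is lifted to z, subtracting its contribution `Vtop f` z leaves a pure
  -- relation among the minors.
  obtain ⟨y, hy⟩ := exists_eq_M₂_mulVec (v ∘ Sum.inl - (Vtop f).mulVec z) (by
    have hc := congrArg (fun A => A.mulVec z) (delta_mul_Vtop_add_F_mul_Y hsupp)
    simp only [Matrix.add_mulVec, ← Matrix.mulVec_mulVec, ← hz, Matrix.zero_mulVec] at hc
    rw [Matrix.mulVec_sub, eq_neg_of_add_eq_zero_left hv, eq_neg_of_add_eq_zero_left hc, sub_self])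
  refine ⟨Sum.elim y z, ?_⟩
  rw [β₂, Matrix.fromBlocks_mulVec, Sum.elim_comp_inl, Sum.elim_comp_inr, ← hy, ← hz,
    Matrix.zero_mulVec, zero_add, sub_add_cancel, Sum.elim_comp_inl_inr]

theorem exact_β₃_β₂ (f : R k) : Function.Exact (β₃ f).mulVecLin (β₂ f).mulVecLin := by
  refine exact_of_exists (β₂_mul_β₃ f) fun v hv => ?_
  rw [β₂, Matrix.fromBlocks_mulVec, Matrix.zero_mulVec, zero_add] at hv
  have hl := congrArg (· ∘ Sum.inl) hv
  have hr := congrArg (· ∘ Sum.inr) hv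
  simp only [Sum.elim_comp_inl, Sum.elim_comp_inr] at hl hr
  obtain ⟨z, hz⟩ := exists_eq_L_mulVec (v ∘ Sum.inr) hr
  obtain ⟨y, hy⟩ := exists_eq_M₃_mulVec (v ∘ Sum.inl - (Ktop f).mulVec z) (by
    have hc := congrArg (fun A => A.mulVec z) (M₂_mul_Ktop_add_Vtop_mul_L f)
    simp only [Matrix.add_mulVec, ← Matrix.mulVec_mulVec, ← hz, Matrix.zero_mulVec] at hc
    rw [Matrix.mulVec_sub, eq_neg_of_add_eq_zero_left hl, eq_neg_of_add_eq_zero_left hc]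
    exact sub_self _)
  refine ⟨Sum.elim y z, ?_⟩
  rw [β₃, Matrix.fromBlocks_mulVec, Sum.elim_comp_inl, Sum.elim_comp_inr, ← hy, ← hz,
    Matrix.zero_mulVec, zero_add, sub_add_cancel, Sum.elim_comp_inl_inr]

/-- The resolution of the even part has stopped here, so injectivity of `M₃` forces the upper part
to equal `Jtop f` z; no correction term is left to choose. -/
theorem exact_β₄_β₃ (f : R k) : Function.Exact (β₄ f).mulVecLin (β₃ f).mulVecLin := by
  refine exact_of_exists (β₃_mul_β₄ f) fun v hv => ?_
  rw [β₃, Matrix.fromBlocks_mulVec, Matrix.zero_mulVec, zero_add] at hv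
  have hl := congrArg (· ∘ Sum.inl) hv
  have hr := congrArg (· ∘ Sum.inr) hv
  simp only [Sum.elim_comp_inl, Sum.elim_comp_inr] at hl hr
  obtain ⟨z, hz⟩ := exists_eq_J'_mulVec (v ∘ Sum.inr) hr
  have h0 := M₃_mulVec_injective (v ∘ Sum.inl - (Jtop f).mulVec z) (by
    have hc := congrArg (fun A => A.mulVec z) (M₃_mul_Jtop_add_Ktop_mul_J' f)
    simp only [Matrix.add_mulVec, ← Matrix.mulVec_mulVec, ← hz, Matrix.zero_mulVec] at hc
    rw [Matrix.mulVec_sub, eq_neg_of_add_eq_zero_left hl, eq_neg_of_add_eq_zero_left hc]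
    exact sub_self _)
  refine ⟨z, ?_⟩
  rw [β₄, Matrix.fromRows_mulVec, ← hz, ← sub_eq_zero.1 h0, Sum.elim_comp_inl_inr]

theorem β₄_injective (f : R k) : Function.Injective (β₄ f).mulVecLin := by
  rw [injective_iff_map_eq_zero]
  intro v hv
  rw [Matrix.mulVecLin_apply, β₄, Matrix.fromRows_mulVec] at hv
  exact J'_mulVec_injective v (congrArg (· ∘ Sum.inr) hv)

theorem augmentation_surjective (I : Ideal (S k)) : Function.Surjective (augmentation I) := by
  intro y
  obtain ⟨x, rfl⟩ := I.mkQ_surjective y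
  exact ⟨fun _ => x, rfl⟩

theorem exact_β₁_augmentation (f : R k) {I : Ideal (S k)}
    (hI : I = Ideal.span (Set.range (delta k) ∪ Set.range (F f))) :
    Function.Exact (β₁ f).mulVecLin (augmentation I) := by
  intro y
  have h1 : augmentation I y = 0 ↔ y 0 ∈ I := Submodule.Quotient.mk_eq_zero I
  rw [h1, hI, ← Set.Sum.elim_range, Ideal.mem_span_range_iff_exists_fun]
  refine exists_congr fun c => ?_
  have h2 : (β₁ f).mulVecLin c 0 = ∑ i, c i * Sum.elim (delta k) (F f) i := by
    rw [Matrix.mulVecLin_apply, Matrix.mulVec, dotProduct]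
    exact Finset.sum_congr rfl fun i _ => mul_comm _ _
  rw [← h2]
  refine ⟨fun h => funext fun i => ?_, fun h => by rw [h]⟩
  rwa [Subsingleton.elim i 0]

theorem isMinimalGradedFreeResolution {f : R k} {n : ℕ} (hf : f.IsHomogeneous (2 * n + 3))
    (hf0 : f ≠ 0) {I : Ideal (S k)}
    (hI : I = Ideal.span (Set.range (delta k) ∪ Set.range (F f))) :
    IsMinimalGradedFreeResolution I
      (Sum.elim (fun _ : Fin 6 => (-2 : ℤ)) (fun _ : Fin 3 => -((n + 2 : ℕ) : ℤ)))
      (Sum.elim (fun _ : Fin 8 => (-3 : ℤ)) (fun _ : Fin 8 => -((n + 2 : ℕ) : ℤ) - 1))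
      (Sum.elim (fun _ : Fin 3 => (-4 : ℤ)) (fun _ : Fin 6 => -((n + 2 : ℕ) : ℤ) - 2))
      (fun _ : Fin 1 => -((n + 2 : ℕ) : ℤ) - 4) (β₁ f) (β₂ f) (β₃ f) (β₄ f) := by
  have d1 : HasPositiveDegrees (fun _ => 0) (Sum.elim (fun _ : Fin 6 => (-2 : ℤ))
      (fun _ : Fin 3 => -((n + 2 : ℕ) : ℤ))) (β₁ f) := by
    rintro i (j | j)
    · exact .inr ⟨2, by simp, by simp, isHomogeneous_delta j⟩
    · exact .inr ⟨n + 2, by simp, by simp, isHomogeneous_F hf j⟩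
  have d2 : HasPositiveDegrees (Sum.elim (fun _ : Fin 6 => (-2 : ℤ))
      (fun _ : Fin 3 => -((n + 2 : ℕ) : ℤ))) (Sum.elim (fun _ : Fin 8 => (-3 : ℤ))
      (fun _ : Fin 8 => -((n + 2 : ℕ) : ℤ) - 1)) (β₂ f) := by
    rintro (i | i) (j | j)
    · exact .inr ⟨1, by simp, by simp, isHomogeneous_M₂ i j⟩
    · exact .inr ⟨n + 1, by simp, by simp; ring, isHomogeneous_Vtop hf i j⟩
    · exact .inl rfl
    · exact .inr ⟨1, by simp, by simp, isHomogeneous_Y i j⟩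
  have d3 : HasPositiveDegrees (Sum.elim (fun _ : Fin 8 => (-3 : ℤ))
      (fun _ : Fin 8 => -((n + 2 : ℕ) : ℤ) - 1)) (Sum.elim (fun _ : Fin 3 => (-4 : ℤ))
      (fun _ : Fin 6 => -((n + 2 : ℕ) : ℤ) - 2)) (β₃ f) := by
    rintro (i | i) (j | j)
    · exact .inr ⟨1, by simp, by simp, isHomogeneous_M₃ i j⟩
    · exact .inr ⟨n + 1, by simp, by simp; ring, isHomogeneous_Ktop hf i j⟩
    · exact .inl rfl
    · exact .inr ⟨1, by simp, by simp, isHomogeneous_L i j⟩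
  have d4 : HasPositiveDegrees (Sum.elim (fun _ : Fin 3 => (-4 : ℤ))
      (fun _ : Fin 6 => -((n + 2 : ℕ) : ℤ) - 2)) (fun _ : Fin 1 => -((n + 2 : ℕ) : ℤ) - 4)
      (β₄ f) := by
    rintro (i | i) j
    · exact .inr ⟨n + 2, by simp, by simp; ring, isHomogeneous_Jtop hf i j⟩
    · exact .inr ⟨2, by simp, by simp, isHomogeneous_J' i j⟩
  exact
    { graded₁ := d1.isGradedMap
      graded₂ := d2.isGradedMap
      graded₃ := d3.isGradedMap
      graded₄ := d4.isGradedMap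
      surjective := augmentation_surjective _
      exact₀ := exact_β₁_augmentation f hI
      exact₁ := exact_β₂_β₁ hf ⟨n + 1, by ring⟩ hf0
      exact₂ := exact_β₃_β₂ f
      exact₃ := exact_β₄_β₃ f
      injective := β₄_injective f
      minimal₁ := d1.isMinimalMatrix
      minimal₂ := d2.isMinimalMatrix
      minimal₃ := d3.isMinimalMatrix
      minimal₄ := d4.isMinimalMatrix }

end MappingCone

end VeroneseCurve

theorem theorem7 {k K : Type*} [Field k] [Field K] [Algebra k K] [IsAlgClosed K]
    (m : ℕ) (hm : 2 ≤ m) (f : VeroneseCurve.R k)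
    (hf : f.IsHomogeneous (2 * m - 1)) (hirr : Irreducible f) :
    (∀ n, VeroneseCurve.theta k (VeroneseCurve.F f n) = MvPolynomial.X n * f) ∧
    VeroneseCurve.homogeneousIdeal k (VeroneseCurve.veronese '' VeroneseCurve.zeros K f) =
      Ideal.span (Set.range (VeroneseCurve.delta k) ∪ Set.range (VeroneseCurve.F f)) ∧
    VeroneseCurve.IsMinimalGradedFreeResolution
      (VeroneseCurve.homogeneousIdeal k (VeroneseCurve.veronese '' VeroneseCurve.zeros K f))
      (Sum.elim (fun _ : Fin 6 => (-2 : ℤ)) (fun _ : Fin 3 => -(m : ℤ)))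
      (Sum.elim (fun _ : Fin 8 => (-3 : ℤ)) (fun _ : Fin 8 => -(m : ℤ) - 1))
      (Sum.elim (fun _ : Fin 3 => (-4 : ℤ)) (fun _ : Fin 6 => -(m : ℤ) - 2))
      (fun _ : Fin 1 => -(m : ℤ) - 4)
      (VeroneseCurve.β₁ f) (VeroneseCurve.β₂ f) (VeroneseCurve.β₃ f) (VeroneseCurve.β₄ f) := by
  obtain ⟨n, rfl⟩ : ∃ n, m = n + 2 := ⟨m - 2, by omega⟩
  have hf' : f.IsHomogeneous (2 * n + 3) := hf
  have hI := VeroneseCurve.homogeneousIdeal_eq (K := K) hm hf hirr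
    (VeroneseCurve.isHomogeneous_F hf')
  exact ⟨VeroneseCurve.theta_F hf' ⟨n + 1, by ring⟩, hI,
    VeroneseCurve.isMinimalGradedFreeResolution hf' hirr.ne_zero hI⟩
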